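/- For an $n$-vertex simple graph $G$ let $\delta(G)$ be its minimum degree and let $q(G)$ be its signless Laplacian spectral radius, i.e. the largest eigenvalue of $Q(G)=D(G)+A(G)$, where $D(G)$ is the diagonal matrix of degrees and $A(G)$ the adjacency matrix. A linear forest is a vertex-disjoint union of paths; $G$ is called $k$-edge-Hamiltonian if every linear forest in $G$ with at most $k$ edges is contained in a Hamilton cycle of $G$. Write $K_s$ for the complete graph and $I_s$ for the edgeless graph on $s$ vertices, $\cup$ for disjoint union and $\vee$ for the join of graphs. Put $$H_{n,k,\delta}=K_\delta\vee(K_{n-2\delta+k}\cup I_{\delta-k}),\qquad L_{n,k,\delta}=K_{k+1}\vee(K_{n-\delta-1}\cup K_{\delta-k}).$$ In $H_{n,k,\delta}$ let $X,Y,Z$ be the vertex sets of $I_{\delta-k}$, $K_\delta$, $K_{n-2\delta+k}$ respectively, and in $L_{n,k,\delta}$ let $X,Y,Z$ be the vertex sets of $K_{\delta-k}$, $K_{k+1}$, $K_{n-\delta-1}$ respectively. In either graph let $E_1$ be the set of edges with both endpoints in $Y\cup Z$. Let $$\mathcal{H}^{(1)}_{n,k,\delta}=\{H_{n,k,\delta}\setminus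 E' : E'\subseteq E_1(H_{n,k,\delta}),\ |E'|\le\lfloor \delta(\delta-k)/4\rfloor\},$$ $$\mathcal{L}^{(1)}_{n,k,\delta}=\{L_{n,k,\delta}\setminus E' : E'\subseteq E_1(L_{n,k,\delta}),\ |E'|\le\lfloor (k+1)(\delta-k)/4\rfloor\},$$ where $\setminus E'$ denotes deletion of the edges in $E'$ and graphs are considered up to isomorphism. **Theorem.** Let $k\ge 0$ and $\delta\ge k+2$ be integers. There is an integer $N=N(k,\delta)$ such that for every $n\ge N$ the following holds. If $G$ is an $n$-vertex graph with $\delta(G)\ge\delta$ and $$q(G)\ge 2(n-\delta+k-1),$$ then $G$ is $k$-edge-Hamiltonian, or $G\in\mathcal{H}^{(1)}_{n,k,\delta}$, or $G\in\mathcal{L}^{(1)}_{n,k,\delta}$. -/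

import Mathlib

namespace SpectralHam

/-- The signless Laplacian matrix `Q(G) = D(G) + A(G)`. -/
def signlessLaplacian {V : Type*} [Fintype V] [DecidableEq V] (G : SimpleGraph V)
    [DecidableRel G.Adj] : Matrix V V ℝ :=
  G.degMatrix ℝ + G.adjMatrix ℝ

/-- The signless Laplacian spectral radius `q(G)`: the largest (real) eigenvalue of `Q(G)`. -/
noncomputable def signlessRadius {V : Type*} [Fintype V] [DecidableEq V] (G : SimpleGraph V)
    [DecidableRel G.Adj] : ℝ :=
  sSup (spectrum ℝ (signlessLaplacian G))

/-- On a nonempty vertex set, `signlessRadius G` is a maximum. -/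
theorem isGreatest_signlessRadius {V : Type*} [Fintype V] [DecidableEq V] [Nonempty V]
    (G : SimpleGraph V) [DecidableRel G.Adj] :
    IsGreatest (spectrum ℝ (signlessLaplacian G)) (signlessRadius G) := by
  have hH : (signlessLaplacian G).IsHermitian :=
    (SimpleGraph.isHermitian_degMatrix ℝ G).add (SimpleGraph.isHermitian_adjMatrix ℝ G)
  have hne : (spectrum ℝ (signlessLaplacian G)).Nonempty :=
    ⟨_, hH.eigenvalues_mem_spectrum_real (Classical.arbitrary V)⟩
  have hfin : (spectrum ℝ (signlessLaplacian G)).Finite := by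
    rw [hH.spectrum_real_eq_range_eigenvalues]
    exact Set.finite_range _
  exact ⟨hne.csSup_mem hfin, fun x hx => le_csSup hfin.bddAbove hx⟩

/-- A linear forest (a vertex-disjoint union of paths, viewed as a spanning graph): an acyclic
graph in which every vertex has degree at most two. -/
def IsLinearForest {V : Type*} (F : SimpleGraph V) : Prop :=
  F.IsAcyclic ∧ ∀ v, (F.neighborSet v).encard ≤ 2

/-- `G` is `k`-edge-Hamiltonian: every linear forest in `G` with at most `k` edges
is contained in a Hamilton cycle of `G`. -/
def IsEdgeHamiltonian {V : Type*} [DecidableEq V] (k : ℕ) (G : SimpleGraph V) : Prop :=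
  ∀ F : SimpleGraph V, F ≤ G → IsLinearForest F → F.edgeSet.encard ≤ k →
    ∃ (a : V) (c : G.Walk a a), c.IsHamiltonianCycle ∧ ∀ e ∈ F.edgeSet, e ∈ c.edges

/-- The join `G ∨ H`: the disjoint union of `G` and `H` together with all edges between them. -/
def join {V W : Type*} (G : SimpleGraph V) (H : SimpleGraph W) : SimpleGraph (V ⊕ W) :=
  G.sum H ⊔ completeBipartiteGraph V W

/-- `H_{n,k,δ} = K_δ ∨ (K_{n-2δ+k} ∪ I_{δ-k})`. The three summands of the vertex type are the
parts `Y`, `Z`, `X`, in this order. (It has `n` vertices when `k ≤ δ` and `2δ ≤ n + k`.) -/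
def graphH (n k δ : ℕ) : SimpleGraph (Fin δ ⊕ (Fin (n + k - 2 * δ) ⊕ Fin (δ - k))) :=
  join (⊤ : SimpleGraph (Fin δ))
    ((⊤ : SimpleGraph (Fin (n + k - 2 * δ))).sum (⊥ : SimpleGraph (Fin (δ - k))))

/-- `L_{n,k,δ} = K_{k+1} ∨ (K_{n-δ-1} ∪ K_{δ-k})`. The three summands of the vertex type are the
parts `Y`, `Z`, `X`, in this order. (It has `n` vertices when `k ≤ δ` and `δ + 1 ≤ n`.) -/
def graphL (n k δ : ℕ) : SimpleGraph (Fin (k + 1) ⊕ (Fin (n - δ - 1) ⊕ Fin (δ - k))) :=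
  join (⊤ : SimpleGraph (Fin (k + 1)))
    ((⊤ : SimpleGraph (Fin (n - δ - 1))).sum (⊤ : SimpleGraph (Fin (δ - k))))

/-- For a graph `B` whose vertex set is split into `Y`, `Z`, `X`: the set `E₁(B)` of the edges
of `B` with both endpoints in `Y ∪ Z`. -/
def edgesYZ {Y Z X : Type*} (B : SimpleGraph (Y ⊕ (Z ⊕ X))) : Set (Sym2 (Y ⊕ (Z ⊕ X))) :=
  {e | e ∈ B.edgeSet ∧ ∀ x : X, Sum.inr (Sum.inr x) ∉ e}

/-- `G` is (isomorphic to) a member of the family `𝓗⁽¹⁾_{n,k,δ}`: a graph obtained from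
`H_{n,k,δ}` by deleting at most `⌊δ(δ-k)/4⌋` edges with both endpoints in `Y ∪ Z`. -/
def InFamilyH {V : Type*} (n k δ : ℕ) (G : SimpleGraph V) : Prop :=
  ∃ E' : Finset (Sym2 (Fin δ ⊕ (Fin (n + k - 2 * δ) ⊕ Fin (δ - k)))),
    (E' : Set _) ⊆ edgesYZ (graphH n k δ) ∧ E'.card ≤ δ * (δ - k) / 4 ∧
      Nonempty (G ≃g (graphH n k δ).deleteEdges (E' : Set _))

/-- `G` is (isomorphic to) a member of the family `𝓛⁽¹⁾_{n,k,δ}`: a graph obtained from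
`L_{n,k,δ}` by deleting at most `⌊(k+1)(δ-k)/4⌋` edges with both endpoints in `Y ∪ Z`. -/
def InFamilyL {V : Type*} (n k δ : ℕ) (G : SimpleGraph V) : Prop :=
  ∃ E' : Finset (Sym2 (Fin (k + 1) ⊕ (Fin (n - δ - 1) ⊕ Fin (δ - k)))),
    (E' : Set _) ⊆ edgesYZ (graphL n k δ) ∧ E'.card ≤ (k + 1) * (δ - k) / 4 ∧
      Nonempty (G ≃g (graphL n k δ).deleteEdges (E' : Set _))

end SpectralHam

/-! Put s = δ - k, so that the hypothesis reads q ≥ 2(n - s - 1). Merris' bound, that q is at most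
some d(u) plus the average degree over N(u), turns this into a degree sum of at least n² - (2s+1)n
(`sum_degree_lower_bound`).

Suppose no Hamilton cycle of G contains a linear forest F with at most k edges, and let H ⊇ G be
edge-maximal with this property. Ore's crossing argument gives d(u) + d(v) < n + k for nonadjacent
u, v in H (`degree_add_degree_lt`). With the degree sum this forces the set X of vertices of degree
below (n+k)/2 to be empty, in which case H is complete, or to have exactly s vertices, all of degree
δ; its complement is a clique, and the set Y of outside neighbours of X is joined to all of X
(`exists_clique_of_closed`). So H[X] is r-regular with r = δ - |Y|. The cases r = 0 and r = s - 1
are the two extremal structures; for 1 ≤ r ≤ s - 2 a count of forest edges extends F to a Hamilton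
cycle of H (`hasHamCycle_of_regular`). Since G has minimum degree at least δ, it contains every edge
of H at X, so it differs from an extremal graph only by missing edges outside X.

An eigenvector for q is nearly 1 off X and nearly 0 on X. In the Rayleigh quotient a missing edge
costs about 4 and each of the s|Y| edges between X and Y gains about 1, so about s|Y|/4 edges at
most are missing; the O(1/n) error disappears by integrality (`two_mul_sum_nbrsIn_compl_le`). -/

namespace SpectralHam

open Finset SimpleGraph

/-! ### Hamilton paths and cycles through a prescribed forest; Ore's crossing argument. -/

section Walks

variable {V : Type*} [DecidableEq V]

/-- `G` has a Hamilton cycle containing all edges of `F`. -/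
def HasHamCycle (G F : SimpleGraph V) : Prop :=
  ∃ (a : V) (c : G.Walk a a), c.IsHamiltonianCycle ∧ ∀ e ∈ F.edgeSet, e ∈ c.edges

/-- `G` has a Hamilton path from `u` to `v` containing all edges of `F`. -/
def HasHamPath (G F : SimpleGraph V) (u v : V) : Prop :=
  ∃ p : G.Walk u v, p.IsHamiltonian ∧ ∀ e ∈ F.edgeSet, e ∈ p.edges

theorem HasHamPath.mono {G G' F : SimpleGraph V} {u v : V} (h : HasHamPath G F u v)
    (hG : G ≤ G') : HasHamPath G' F u v := by
  obtain ⟨p, hp, hF⟩ := h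
  refine ⟨p.mapLe hG, ?_, ?_⟩
  · intro a; simpa using hp a
  · intro e he; simpa using hF e he

theorem HasHamPath.hasHamCycle [Fintype V] {G F : SimpleGraph V} {u v : V}
    (h : HasHamPath G F u v) (hadj : G.Adj u v) (hV : 3 ≤ Fintype.card V) :
    HasHamCycle G F := by
  obtain ⟨p, hp, hF⟩ := h
  have hlen := hp.length_eq
  refine ⟨v, Walk.cons hadj.symm p, ⟨?_, ?_⟩, ?_⟩
  · rw [Walk.cons_isCycle_iff]
    refine ⟨hp.isPath, fun he => ?_⟩
    rw [Sym2.eq_swap] at he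
    -- A closing edge lying on the path would make the path have length 1, against three vertices.
    have h1 := hp.isPath.eq_snd_of_mem_edges he
    have h2 : p.getVert 1 = p.getVert p.length := by
      rw [Walk.getVert_length]; exact h1.symm
    have := hp.isPath.getVert_injOn (by simp; omega) (by simp) h2
    omega
  · intro a
    simpa using hp a
  · intro e he
    simp [hF e he]

/-- A cycle avoiding uv already lives in G, so the cycle uses uv; deleting that edge leaves the
path. No edge of F is lost, since uv is not in G ⊇ F. -/
theorem HasHamCycle.hasHamPath {G F : SimpleGraph V} {u v : V} (huv : u ≠ v) (hFG : F ≤ G)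
    (hG : ¬ G.Adj u v)
    (h : HasHamCycle (G ⊔ edge u v) F) (hn : ¬ HasHamCycle G F) : HasHamPath G F u v := by
  obtain ⟨a, c, hc, hF⟩ := h
  have key : ∀ {x y : V} (p : (G ⊔ edge u v).Walk x y), s(u, v) ∉ p.edges →
      ∀ e ∈ p.edges, e ∈ G.edgeSet := by
    intro x y p hp e he
    have h1 := p.edges_subset_edgeSet he
    induction e with | h x y =>
    rw [mem_edgeSet, sup_adj, edge_adj] at h1
    rcases h1 with h1 | ⟨⟨rfl, rfl⟩ | ⟨rfl, rfl⟩, -⟩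
    · exact h1
    · exact (hp he).elim
    · exact (hp (Sym2.eq_swap ▸ he)).elim
  by_cases hm : s(u, v) ∈ c.edges
  swap
  · exact (hn ⟨a, c.transfer G (key c hm), ⟨hc.isCycle.transfer _, by
      intro b
      have := hc.isHamiltonian_tail b
      rw [Walk.support_tail_of_not_nil _ hc.isCycle.not_nil] at this
      rw [Walk.support_tail_of_not_nil _ (hc.isCycle.transfer _).not_nil]
      simpa using this⟩, by simpa using hF⟩).elim
  have hu : u ∈ c.support := hc.mem_support u
  have main : ∀ c' : (G ⊔ edge u v).Walk u u, c'.IsHamiltonianCycle →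
      (∀ e ∈ F.edgeSet, e ∈ c'.edges) → c'.snd = v → HasHamPath G F v u := by
    intro c' hc' hF' hsnd
    cases c' with
    | nil => exact (hc'.isCycle.not_nil (by simp)).elim
    | @cons _ w _ h p =>
      simp only [Walk.snd_cons] at hsnd
      subst hsnd
      have hp := (Walk.cons_isCycle_iff _ _).1 hc'.isCycle
      have hham : p.IsHamiltonian := by
        intro b
        have := hc'.isHamiltonian_tail b
        simpa using this
      refine ⟨p.transfer G (key p hp.2), ?_, ?_⟩
      · intro b; simpa using hham b
      · intro e he
        have h3 := hF' e he
        rw [Walk.edges_cons, List.mem_cons] at h3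
        rw [Walk.edges_transfer]
        rcases h3 with rfl | h3
        · exact (hG (hFG he)).elim
        · exact h3
  have hrev : ∀ {x y : V}, HasHamPath G F x y → HasHamPath G F y x := by
    rintro x y ⟨p, hp, hpF⟩
    exact ⟨p.reverse, fun b => by simpa using hp b, fun e he => by simpa using hpF e he⟩
  have hc1 : (c.rotate u hu).IsHamiltonianCycle := hc.rotate hu
  have hF1 : ∀ e, e ∈ (c.rotate u hu).edges ↔ e ∈ c.edges := fun e =>
    (c.rotate_edges u hu).mem_iff
  generalize c.rotate u hu = c1 at hc1 hF1
  have hm1 := (hF1 _).2 hm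
  have hF2 : ∀ e ∈ F.edgeSet, e ∈ c1.edges := fun e he => (hF1 e).2 (hF e he)
  -- Started at u, the cycle traverses uv first or last; reversal reduces the second case to the
  -- first.
  by_cases hs : c1.snd = v
  · exact hrev (main c1 hc1 hF2 hs)
  · have hpen : c1.reverse.snd = v := by
      rw [Walk.snd_reverse]
      cases c1 with
      | nil => exact (hc1.isCycle.not_nil (by simp)).elim
      | @cons _ w _ h p =>
        have hp := (Walk.cons_isCycle_iff _ _).1 hc1.isCycle
        rw [Walk.edges_cons, List.mem_cons] at hm1
        rcases hm1 with h1 | h1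
        · simp only [Walk.snd_cons] at hs
          rw [Sym2.eq_iff] at h1
          rcases h1 with ⟨-, h1⟩ | ⟨h1, h2⟩
          · exact (hs h1.symm).elim
          · exact (hs (h1 ▸ h2.symm)).elim
        · have h2 : v = p.penultimate := hp.1.eq_penultimate_of_mem_edges h1
          rw [Walk.penultimate_cons_of_not_nil]
          · exact h2.symm
          intro hnil
          cases hnil
          simp at h1
    refine hrev (main c1.reverse ?_ (by simpa using hF2) hpen)
    refine ⟨hc1.isCycle.reverse, ?_⟩
    have hp : c1.reverse.tail.IsPath := hc1.isCycle.reverse.isPath_tail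
    refine hp.isHamiltonian_of_mem fun w => ?_
    rw [Walk.support_tail_of_not_nil _ hc1.isCycle.reverse.not_nil]
    have := hc1.mem_support w
    have h2 : w ∈ c1.reverse.support := by simpa using this
    rw [Walk.mem_support_iff] at h2
    rcases h2 with rfl | h2
    · exact Walk.end_mem_tail_support hc1.isCycle.reverse.not_nil
    · exact h2

omit [DecidableEq V] in
theorem exists_eq_append_cons {G : SimpleGraph V} {u v : V} (p : G.Walk u v) {i : ℕ}
    (hi : i < p.length) : ∃ (a b : V) (p₁ : G.Walk u a) (h : G.Adj a b) (p₂ : G.Walk b v),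
      p = p₁.append (Walk.cons h p₂) ∧ a = p.getVert i ∧ b = p.getVert (i + 1) := by
  induction p generalizing i with
  | nil => simp at hi
  | @cons a b c h p ih =>
    cases i with
    | zero => exact ⟨a, b, Walk.nil, h, p, by simp⟩
    | succ i =>
      obtain ⟨x, y, p₁, h', p₂, he, hx, hy⟩ := ih (i := i) (by simpa using hi)
      refine ⟨x, y, Walk.cons h p₁, h', p₂, ?_, ?_, ?_⟩
      · rw [he, Walk.cons_append]
      · simpa using hx
      · simpa using hy

/-- Write ab for the path edge at position i. The cycle u … a v … b u drops only ab, which is not in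
F. -/
theorem hasHamCycle_of_crossing [Fintype V] (hV : 3 ≤ Fintype.card V) {G F : SimpleGraph V}
    {u v : V} (p : G.Walk u v) (hp : p.IsHamiltonian) (hF : ∀ e ∈ F.edgeSet, e ∈ p.edges)
    {i : ℕ} (hi : i < p.length) (h1 : G.Adj u (p.getVert (i + 1))) (h2 : G.Adj (p.getVert i) v)
    (hnF : ¬ F.Adj (p.getVert i) (p.getVert (i + 1))) : HasHamCycle G F := by
  obtain ⟨a, b, p₁, h, p₂, he, ha, hb⟩ := exists_eq_append_cons p hi
  rw [← ha] at h2 hnF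
  rw [← hb] at h1 hnF
  refine HasHamPath.hasHamCycle (u := u) (v := b) ⟨p₁.append (Walk.cons h2 p₂.reverse), ?_, ?_⟩
    h1 hV
  · intro w
    have := hp w
    rw [he, Walk.support_append] at this
    rw [Walk.support_append]
    simpa using this
  · intro e hee
    have := hF e hee
    rw [he, Walk.edges_append, List.mem_append, Walk.edges_cons, List.mem_cons] at this
    rw [Walk.edges_append, List.mem_append, Walk.edges_cons, List.mem_cons]
    rcases this with h | rfl | h
    · exact Or.inl h
    · exact (hnF hee).elim
    · exact Or.inr (Or.inr (by simpa using h))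

open scoped Classical in
theorem degree_add_degree_lt [Fintype V] (hV : 3 ≤ Fintype.card V) {G F : SimpleGraph V}
    {u v : V} {k : ℕ} (hk : F.edgeFinset.card ≤ k) (h : HasHamPath G F u v)
    (hn : ¬ HasHamCycle G F) : G.degree u + G.degree v < Fintype.card V + k := by
  obtain ⟨p, hp, hF⟩ := h
  have hlen : p.length + 1 = Fintype.card V := by
    rw [hp.length_eq]; omega
  have hmem : ∀ w, ∃ i ≤ p.length, p.getVert i = w := fun w => by
    obtain ⟨i, hi, hi'⟩ := (Walk.mem_support_iff_exists_getVert (p := p)).1 (hp.mem_support w)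
    exact ⟨i, hi', hi⟩
  set S := (range p.length).filter (fun i => G.Adj u (p.getVert (i + 1))) with hS
  set T := (range p.length).filter (fun i => G.Adj (p.getVert i) v) with hT
  set E := (range p.length).filter (fun i => F.Adj (p.getVert i) (p.getVert (i + 1))) with hE
  have hSc : G.degree u ≤ S.card := by
    rw [← card_neighborFinset_eq_degree]
    refine (card_le_card (t := S.image fun i => p.getVert (i + 1)) ?_).trans card_image_le
    intro w hw
    rw [mem_neighborFinset] at hw
    obtain ⟨i, hi, rfl⟩ := hmem w
    cases i with
    | zero => simp at hw
    | succ i =>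
      rw [mem_image]
      exact ⟨i, by rw [hS, mem_filter, mem_range]; exact ⟨by omega, hw⟩, rfl⟩
  have hTc : G.degree v ≤ T.card := by
    rw [← card_neighborFinset_eq_degree]
    refine (card_le_card (t := T.image fun i => p.getVert i) ?_).trans card_image_le
    intro w hw
    rw [mem_neighborFinset] at hw
    obtain ⟨i, hi, rfl⟩ := hmem w
    have : i ≠ p.length := by rintro rfl; simp at hw
    rw [mem_image]
    exact ⟨i, by rw [hT, mem_filter, mem_range]; exact ⟨by omega, hw.symm⟩, rfl⟩
  have hEc : E.card ≤ k := by
    refine le_trans ?_ hk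
    refine card_le_card_of_injOn (fun i => s(p.getVert i, p.getVert (i + 1))) ?_ ?_
    · intro i hi
      rw [hE, mem_coe, mem_filter] at hi
      simpa using hi.2
    · intro i hi j hj hij
      rw [hE, mem_coe, mem_filter, mem_range] at hi hj
      have inj := hp.isPath.getVert_injOn
      simp only [Sym2.eq_iff] at hij
      rcases hij with ⟨h1, -⟩ | ⟨h1, h2⟩
      · exact inj (by simp; omega) (by simp; omega) h1
      · have e1 := inj (by simp; omega) (by simp; omega) h1
        have e2 := inj (by simp; omega) (by simp; omega) h2
        omega
  by_contra hcon
  have hU : (S ∪ T).card ≤ p.length := by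
    rw [← card_range p.length]
    exact card_le_card (union_subset (filter_subset _ _) (filter_subset _ _))
  have hI := card_union_add_card_inter S T
  -- S and T lie among n - 1 positions and have total size at least n + k, so they share at least k
  -- + 1, of which at most k carry edges of F.
  obtain ⟨i, hi, hiE⟩ : ∃ i ∈ S ∩ T, i ∉ E := by
    by_contra hno
    push Not at hno
    have := card_le_card (show S ∩ T ⊆ E from hno)
    omega
  rw [mem_inter, hS, hT, mem_filter, mem_filter, mem_range] at hi
  refine hn (hasHamCycle_of_crossing hV p hp hF hi.1.1 hi.1.2 hi.2.2 fun hh => hiE ?_)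
  rw [hE, mem_filter, mem_range]
  exact ⟨hi.1.1, hh⟩

end Walks

/-! ### Linear forests and their maximal extensions. -/

section Forests

open scoped Classical

variable {V : Type*} [Fintype V]

theorem isLinearForest_iff {F : SimpleGraph V} :
    IsLinearForest F ↔ F.IsAcyclic ∧ ∀ v, F.degree v ≤ 2 := by
  have : ∀ v, (F.neighborSet v).encard = (F.degree v : ℕ∞) := fun v => by
    rw [← card_neighborFinset_eq_degree, ← Set.encard_coe_eq_coe_finsetCard,
      coe_neighborFinset]
  unfold IsLinearForest
  simp_rw [this]
  norm_cast

/-- A path between distinct vertices of degree at most one contains every edge at each of its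
vertices, and all its other vertices have degree two. -/
theorem mem_edges_of_isPath {P : SimpleGraph V} (hP : ∀ v, P.degree v ≤ 2) {u v : V}
    (huv : u ≠ v) (hu : P.degree u ≤ 1) (hv : P.degree v ≤ 1) {q : P.Walk u v} (hq : q.IsPath)
    {w : V} (hw : w ∈ q.support) :
    (∀ x, P.Adj w x → s(w, x) ∈ q.edges) ∧ (w ≠ u → w ≠ v → P.degree w = 2) := by
  have hnil : ¬ q.Nil := fun h => huv h.eq
  have key : ∀ {n : ℕ}, P.degree w ≤ n → (q.toSubgraph.neighborSet w).ncard = n →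
      (∀ x, P.Adj w x → s(w, x) ∈ q.edges) ∧ P.degree w = n := by
    intro n hd hn
    have hsub : q.toSubgraph.neighborSet w ⊆ P.neighborSet w := fun x hx => hx.adj_sub
    have hc : (P.neighborSet w).ncard = P.degree w := by
      rw [← card_neighborFinset_eq_degree, ← Set.ncard_coe_finset, coe_neighborFinset]
    have heq := Set.eq_of_subset_of_ncard_le hsub (by omega) (Set.toFinite _)
    refine ⟨fun x hx => ?_, ?_⟩
    · have : x ∈ q.toSubgraph.neighborSet w := by rw [heq]; exact hx
      exact Walk.adj_toSubgraph_iff_mem_edges.1 this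
    · rw [← hc, ← heq, hn]
  obtain ⟨i, rfl, hi⟩ := Walk.mem_support_iff_exists_getVert.1 hw
  rcases Nat.eq_zero_or_pos i with rfl | hi0
  · rw [Walk.getVert_zero] at *
    exact ⟨(key hu (by rw [hq.neighborSet_toSubgraph_startpoint hnil]; simp)).1,
      fun h => (h rfl).elim⟩
  rcases hi.eq_or_lt with rfl | hil
  · rw [Walk.getVert_length] at *
    exact ⟨(key hv (by rw [hq.neighborSet_toSubgraph_endpoint hnil]; simp)).1,
      fun _ h => (h rfl).elim⟩
  · have := key (hP _) (hq.ncard_neighborSet_toSubgraph_internal_eq_two hi0.ne' hil)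
    exact ⟨this.1, fun _ _ => this.2⟩

theorem mem_support_of_reachable {P : SimpleGraph V} (hP : ∀ v, P.degree v ≤ 2) {u v : V}
    (huv : u ≠ v) (hu : P.degree u ≤ 1) (hv : P.degree v ≤ 1) {q : P.Walk u v} (hq : q.IsPath)
    {w : V} (hw : P.Reachable u w) : w ∈ q.support := by
  obtain ⟨r⟩ := hw
  have : ∀ {a b : V} (_ : P.Walk a b), a ∈ q.support → b ∈ q.support := by
    intro a b r
    induction r with
    | nil => exact id
    | cons h p ih =>
      exact fun ha => ih (q.snd_mem_support_of_mem_edges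
        ((mem_edges_of_isPath hP huv hu hv hq ha).1 _ h))
  exact this r q.start_mem_support

/-- A component with two vertices of degree at most one is a path between them, and its inner
vertices have degree two. -/
theorem not_reachable_of_degree_le_one {P : SimpleGraph V} (hP : ∀ v, P.degree v ≤ 2)
    {u v w : V} (huv : u ≠ v) (huw : u ≠ w) (hvw : v ≠ w) (hu : P.degree u ≤ 1)
    (hv : P.degree v ≤ 1) (hw : P.degree w ≤ 1) (h : P.Reachable u v) : ¬ P.Reachable u w := by
  intro h'
  obtain ⟨q, hq⟩ := h.exists_isPath
  have := (mem_edges_of_isPath hP huv hu hv hq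
    (mem_support_of_reachable hP huv hu hv hq h')).2 huw.symm hvw.symm
  omega

theorem IsLinearForest.sup_edge {P : SimpleGraph V} (hP : IsLinearForest P) {u v : V}
    (hu : P.degree u ≤ 1) (hv : P.degree v ≤ 1) (h : ¬ P.Reachable u v) :
    IsLinearForest (P ⊔ edge u v) := by
  rw [isLinearForest_iff] at hP ⊢
  refine ⟨hP.1.sup_edge_of_not_reachable h, fun w => ?_⟩
  generalize hQ : P ⊔ edge u v = Q
  have hle : Q.degree w ≤ P.degree w + (edge u v).degree w := by
    simp only [← card_neighborFinset_eq_degree]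
    refine le_trans (card_le_card ?_) (card_union_le _ _)
    intro x hx
    rw [mem_neighborFinset, ← hQ] at hx
    simpa using hx
  have hed : (edge u v).degree w ≤ 1 := by
    rw [← card_neighborFinset_eq_degree, card_le_one]
    intro a ha b hb
    rw [mem_neighborFinset, edge_adj] at ha hb
    grind
  by_cases hw : w = u ∨ w = v
  · rcases hw with rfl | rfl <;> omega
  · have : (edge u v).degree w = 0 := by
      rw [← card_neighborFinset_eq_degree, card_eq_zero, eq_empty_iff_forall_notMem]
      intro a ha
      rw [mem_neighborFinset, edge_adj] at ha
      grind
    have := hP.2 w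
    omega

/-- In a forest, an end of a longest path has no neighbour off that path and only one on it. -/
theorem exists_degree_le_one {W : Type*} [Finite W] [Nonempty W] {H : SimpleGraph W}
    (hH : H.IsAcyclic) : ∃ u, ∀ v w, H.Adj u v → H.Adj u w → v = w := by
  obtain ⟨u, v, p, hp, hmax⟩ := Walk.exists_isPath_forall_isPath_length_le_length H
  refine ⟨u, ?_⟩
  have : ∀ w, H.Adj u w → w = p.snd := by
    intro w hw
    apply hH.eq_snd_of_adj_start hp hw
    by_contra hcon
    have := hmax _ _ _ (hp.cons (h := hw.symm) hcon)
    simp at this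
  intro v w hv hw
  rw [this v hv, this w hw]

theorem exists_mem_card_neighbor_le_one {P : SimpleGraph V} (hP : P.IsAcyclic) {S : Finset V}
    (hS : S.Nonempty) : ∃ u ∈ S, (S.filter fun v => P.Adj u v).card ≤ 1 := by
  have : Nonempty (S : Set V) := hS.to_subtype
  obtain ⟨⟨u, hu⟩, h⟩ := exists_degree_le_one (hP.induce (S : Set V))
  refine ⟨u, hu, card_le_one.2 fun a ha b hb => ?_⟩
  rw [mem_filter] at ha hb
  simpa using h ⟨a, ha.1⟩ ⟨b, hb.1⟩ (by simpa using ha.2) (by simpa using hb.2)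

theorem exists_reachable_degree_le_one {P : SimpleGraph V} (hP : P.IsAcyclic) (a : V) :
    ∃ u, P.Reachable a u ∧ P.degree u ≤ 1 := by
  obtain ⟨u, hu, h⟩ := exists_mem_card_neighbor_le_one hP
    (S := univ.filter fun v => P.Reachable a v) ⟨a, by simp⟩
  simp only [mem_filter, mem_univ, true_and] at hu
  refine ⟨u, hu, le_trans (le_of_eq ?_) h⟩
  rw [← card_neighborFinset_eq_degree]
  congr 1
  ext x
  simp only [mem_neighborFinset, mem_filter, mem_univ, true_and]
  exact ⟨fun hx => ⟨hu.trans hx.reachable, hx⟩, fun hx => hx.2⟩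

theorem IsLinearForest.hasHamPath [Nontrivial V] {M : SimpleGraph V} (hM : IsLinearForest M)
    (hc : M.Connected) : ∃ u v, M.degree u ≤ 1 ∧ M.degree v ≤ 1 ∧ u ≠ v ∧
      HasHamPath M M u v := by
  rw [isLinearForest_iff] at hM
  obtain ⟨u, v, huv, hu, hv⟩ := (IsTree.mk hc hM.1).exists_ne_and_degree_eq_one
  obtain ⟨q, hq⟩ := hc.exists_isPath u v
  have hs : ∀ w, w ∈ q.support := fun w =>
    mem_support_of_reachable hM.2 huv hu.le hv.le hq (hc.preconnected u w)
  refine ⟨u, v, hu.le, hv.le, huv, q, hq.isHamiltonian_of_mem hs, fun e => ?_⟩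
  induction e with | h a b =>
  exact fun h => (mem_edges_of_isPath hM.2 huv hu.le hv.le hq (hs a)).1 b h

omit [Fintype V] in
theorem HasHamCycle.anti {G F F' : SimpleGraph V} (h : HasHamCycle G F') (hF : F ≤ F') :
    HasHamCycle G F := by
  obtain ⟨a, c, hc, h'⟩ := h
  exact ⟨a, c, hc, fun e he => h' e (edgeSet_mono hF he)⟩

/-- An edge of G between path ends in different components could still be added. -/
theorem exists_maximal_isLinearForest {P G : SimpleGraph V} (hP : IsLinearForest P)
    (hPG : P ≤ G) : ∃ M, P ≤ M ∧ M ≤ G ∧ IsLinearForest M ∧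
      ∀ u v, G.Adj u v → M.degree u ≤ 1 → M.degree v ≤ 1 → M.Reachable u v := by
  obtain ⟨M, hPM, hM⟩ := (Set.toFinite {M | M ≤ G ∧ IsLinearForest M}).exists_le_maximal
    (a := P) ⟨hPG, hP⟩
  refine ⟨M, hPM, hM.1.1, hM.1.2, fun u v huv hu hv => ?_⟩
  by_contra hcon
  have hle : M ⊔ edge u v ≤ M := hM.2 ⟨sup_le hM.1.1 ((edge_le_iff _).2 (Or.inr huv)),
    hM.1.2.sup_edge hu hv hcon⟩ le_sup_left
  have : M.Adj u v := hle (by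
    rw [sup_adj, edge_adj]; exact Or.inr ⟨Or.inl ⟨rfl, rfl⟩, huv.ne⟩)
  exact hcon this.reachable

/-- In a maximal extension of P all path ends avoid X, hence are pairwise adjacent, hence lie in one
component. The extension is then a Hamilton path with adjacent ends. -/
theorem IsLinearForest.hasHamCycle {G P : SimpleGraph V} (hV : 3 ≤ Fintype.card V)
    (hP : IsLinearForest P) (hPG : P ≤ G) {X : Finset V} (hX : ∀ x ∈ X, 2 ≤ P.degree x)
    (hG : ∀ u v, u ∉ X → v ∉ X → u ≠ v → G.Adj u v) : HasHamCycle G P := by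
  obtain ⟨M, hPM, hMG, hM, hmax⟩ := exists_maximal_isLinearForest hP hPG
  have hnX : ∀ u, M.degree u ≤ 1 → u ∉ X := fun u hu hux => by
    have := hX u hux
    have := degree_le_of_le (v := u) hPM
    omega
  have : Nontrivial V := Fintype.one_lt_card_iff_nontrivial.1 (by omega)
  have hc : M.Connected := by
    refine ⟨fun a b => ?_⟩
    obtain ⟨u, hau, hu⟩ := exists_reachable_degree_le_one hM.1 a
    obtain ⟨v, hbv, hv⟩ := exists_reachable_degree_le_one hM.1 b
    rcases eq_or_ne u v with rfl | huv
    · exact hau.trans hbv.symm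
    · exact (hau.trans (hmax u v (hG u v (hnX u hu) (hnX v hv) huv) hu hv)).trans hbv.symm
  obtain ⟨u, v, hu, hv, huv, h⟩ := hM.hasHamPath hc
  exact ((h.mono hMG).hasHamCycle (hG u v (hnX u hu) (hnX v hv) huv) hV).anti hPM

end Forests

/-! ### Counting forest edges when G[X] is regular. -/

section Counting

open scoped Classical

variable {V : Type*} [Fintype V]

theorem degree_pos_of_reachable {P : SimpleGraph V} {u v : V} (h : P.Reachable u v)
    (huv : u ≠ v) : 0 < P.degree u := by
  obtain ⟨p⟩ := h
  cases p with
  | nil => exact (huv rfl).elim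
  | cons h p => exact (P.degree_pos_iff_exists_adj u).2 ⟨_, h⟩

/-- The number of neighbours of `u` in `S`. -/
noncomputable def nbrsIn (P : SimpleGraph V) (S : Finset V) (u : V) : ℕ :=
  (S.filter fun v => P.Adj u v).card

theorem nbrsIn_univ (P : SimpleGraph V) (u : V) : nbrsIn P univ u = P.degree u := by
  rw [← card_neighborFinset_eq_degree, nbrsIn]
  congr 1
  ext x
  simp

omit [Fintype V] in
theorem nbrsIn_union {P : SimpleGraph V} {S T : Finset V} (h : Disjoint S T) (u : V) :
    nbrsIn P (S ∪ T) u = nbrsIn P S u + nbrsIn P T u := by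
  rw [nbrsIn, filter_union, card_union_of_disjoint (disjoint_filter_filter h)]
  rfl

theorem nbrsIn_add_compl (P : SimpleGraph V) (S : Finset V) (u : V) :
    nbrsIn P S u + nbrsIn P Sᶜ u = P.degree u := by
  rw [← nbrsIn_union disjoint_compl_right, union_compl, nbrsIn_univ]

omit [Fintype V] in
theorem sum_nbrsIn_comm (P : SimpleGraph V) (S T : Finset V) :
    ∑ u ∈ S, nbrsIn P T u = ∑ v ∈ T, nbrsIn P S v := by
  have := sum_card_bipartiteAbove_eq_sum_card_bipartiteBelow (s := S) (t := T) P.Adj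
  simp only [bipartiteAbove, bipartiteBelow] at this
  simp only [nbrsIn]
  rw [this]
  simp_rw [P.adj_comm]

omit [Fintype V] in
theorem nbrsIn_congr {P Q : SimpleGraph V} {S : Finset V} {u : V}
    (h : ∀ v ∈ S, P.Adj u v ↔ Q.Adj u v) : nbrsIn P S u = nbrsIn Q S u := by
  unfold nbrsIn
  congr 1
  exact filter_congr h

omit [Fintype V] in
theorem nbrsIn_eq_of_subset {P : SimpleGraph V} {S T : Finset V} {u : V} (hST : S ⊆ T)
    (h : ∀ v ∈ T, P.Adj u v → v ∈ S) : nbrsIn P S u = nbrsIn P T u := by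
  unfold nbrsIn
  congr 1
  ext v
  simp only [mem_filter]
  exact ⟨fun hv => ⟨hST hv.1, hv.2⟩, fun hv => ⟨h v hv.1 hv.2, hv.2⟩⟩

/-- Two such vertices would, with x, be three ends of one path. -/
theorem card_filter_degree_le_one {P : SimpleGraph V} (hP : IsLinearForest P) {x : V}
    (hx : P.degree x ≤ 1) {S : Finset V} (hxS : x ∉ S)
    (hS : ∀ v ∈ S, P.degree v ≤ 1 → P.Reachable x v) :
    (S.filter fun v => P.degree v ≤ 1).card ≤ 1 := by
  refine card_le_one.2 fun a ha b hb => ?_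
  rw [mem_filter] at ha hb
  by_contra hab
  exact not_reachable_of_degree_le_one (isLinearForest_iff.1 hP).2 (ne_of_mem_of_not_mem ha.1 hxS).symm
    (ne_of_mem_of_not_mem hb.1 hxS).symm hab hx ha.2 hb.2 (hS a ha.1 ha.2) (hS b hb.1 hb.2)

/-- A linear forest that cannot be extended within a regular graph on `X` has many edges
at `X`. -/
theorem two_mul_lt_sum_degree {P G : SimpleGraph V} (hP : IsLinearForest P) {X : Finset V}
    {r : ℕ} (hr : 1 ≤ r) (hrX : r + 2 ≤ X.card) (hreg : ∀ x ∈ X, nbrsIn G X x = r)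
    (hmax : ∀ u ∈ X, ∀ v ∈ X, G.Adj u v → P.degree u ≤ 1 → P.degree v ≤ 1 → P.Reachable u v) :
    2 * r + 1 ≤ ∑ x ∈ X, (P.degree x + nbrsIn P Xᶜ x) := by
  have hNX : ∀ x, X.filter (fun v => G.Adj x v) ⊆ X := fun x => filter_subset _ _
  -- The sum is twice the number of edges of P meeting X. If x is isolated in P, maximality makes
  -- all its r neighbours in X saturated, which gives 2r; an edge leaving this neighbourhood gives
  -- the extra 1.
  by_cases h0 : ∃ x ∈ X, P.degree x = 0
  · obtain ⟨x, hx, hx0⟩ := h0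
    set N := X.filter fun v => G.Adj x v with hN
    have hNc : N.card = r := hreg x hx
    have hN2 : ∀ w ∈ N, P.degree w = 2 := by
      intro w hw
      rw [hN, mem_filter] at hw
      refine le_antisymm ((isLinearForest_iff.1 hP).2 w) ?_
      by_contra hlt
      have := degree_pos_of_reachable (hmax x hx w hw.1 hw.2 (by omega) (by omega)) hw.2.ne
      omega
    obtain ⟨w, hw, hw1⟩ := exists_mem_card_neighbor_le_one hP.1 (S := N)
      (card_pos.1 (by omega))
    have hsum : ∑ x ∈ N, P.degree x = 2 * r := by
      rw [sum_congr rfl hN2, sum_const, hNc, smul_eq_mul, mul_comm]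
    have hout : 0 < nbrsIn P Nᶜ w := by
      have h1 := nbrsIn_add_compl P N w
      have h2 := hN2 w hw
      have h3 : nbrsIn P N w ≤ 1 := hw1
      omega
    obtain ⟨w', hw'⟩ := card_pos.1 hout
    rw [mem_filter, mem_compl] at hw'
    rw [sum_add_distrib]
    by_cases hwX : w' ∈ X
    · have h1 : ∑ x ∈ insert w' N, P.degree x ≤ ∑ x ∈ X, P.degree x :=
        sum_le_sum_of_subset (insert_subset hwX (hNX x))
      rw [sum_insert hw'.1, hsum] at h1
      have : 0 < P.degree w' := (P.degree_pos_iff_exists_adj w').2 ⟨w, hw'.2.symm⟩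
      omega
    · have h1 : ∑ x ∈ N, P.degree x ≤ ∑ x ∈ X, P.degree x :=
        sum_le_sum_of_subset (hNX x)
      have h2 : nbrsIn P Xᶜ w ≤ ∑ x ∈ X, nbrsIn P Xᶜ x :=
        single_le_sum (f := fun x => nbrsIn P Xᶜ x) (fun _ _ => Nat.zero_le _) (hNX x hw)
      have h3 : 0 < nbrsIn P Xᶜ w := card_pos.2 ⟨w', by simp [hwX, hw'.2]⟩
      omega
  · push Not at h0
    refine le_trans ?_ (sum_le_sum fun x _ => Nat.le_add_right _ _)
    by_cases h2 : ∀ x ∈ X, 2 ≤ P.degree x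
    · have := card_nsmul_le_sum X _ 2 h2
      rw [smul_eq_mul] at this
      omega
    · push Not at h2
      obtain ⟨x, hx, hx2⟩ := h2
      set N := X.filter fun v => G.Adj x v with hN
      have hNc : N.card = r := hreg x hx
      have hN1 := card_filter_degree_le_one hP (x := x) (by omega) (S := N) (by simp [hN])
        (fun v hv hv1 => by
          rw [hN, mem_filter] at hv
          exact hmax x hx v hv.1 hv.2 (by omega) hv1)
      have h3 := card_filter_add_card_filter_not (s := N) (fun v => P.degree v ≤ 1)
      -- Every one of the at least r + 2 vertices counts once, and at least r - 1 neighbours of x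
      -- count twice, because only the other end of the path at x can be unsaturated.
      have h4 : ∑ v ∈ X, (1 + if v ∈ N.filter (fun v => ¬ P.degree v ≤ 1) then 1 else 0) ≤
          ∑ v ∈ X, P.degree v := by
        refine sum_le_sum fun v hv => ?_
        have := Nat.pos_of_ne_zero (h0 v hv)
        split_ifs with h
        · rw [mem_filter] at h; omega
        · omega
      rw [sum_add_distrib, sum_ite_mem, 
        inter_eq_right.2 ((filter_subset _ N).trans (show N ⊆ X from hNX x))] at h4
      simp only [sum_const, smul_eq_mul, mul_one] at h4
      omega

/-- F is extended greedily, first inside X, then by edges between X and Y. If this saturates X, the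
clique outside X finishes the cycle. Otherwise an unsaturated x in X forces all of Y but one vertex
to be saturated, and F would need more than k edges. -/
theorem hasHamCycle_of_regular {G F : SimpleGraph V} {X Y : Finset V} {s k y r : ℕ}
    (hV : 3 ≤ Fintype.card V) (hF : IsLinearForest F) (hFG : F ≤ G)
    (hFk : F.edgeFinset.card ≤ k) (hXY : Disjoint X Y) (hX : X.card = s) (hY : Y.card = y)
    (hyr : y + r = s + k) (hr : 1 ≤ r) (hrs : r + 2 ≤ s)
    (hclique : ∀ u v, u ∉ X → v ∉ X → u ≠ v → G.Adj u v)
    (hjoin : ∀ u ∈ X, ∀ v ∈ Y, G.Adj u v)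
    (hXZ : ∀ u ∈ X, ∀ v, v ∉ X → G.Adj u v → v ∈ Y)
    (hreg : ∀ x ∈ X, nbrsIn G X x = r) : HasHamCycle G F := by
  let GX : SimpleGraph V := ⟨fun u v => G.Adj u v ∧ u ∈ X ∧ v ∈ X,
    ⟨fun u v h => ⟨h.1.symm, h.2.2, h.2.1⟩⟩, ⟨fun u h => h.1.ne rfl⟩⟩
  let B : SimpleGraph V := ⟨fun u v => (u ∈ X ∧ v ∈ Y) ∨ (u ∈ Y ∧ v ∈ X),
    ⟨fun u v h => by tauto⟩, ⟨fun u h => by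
      rcases h with h | h
      · exact disjoint_left.1 hXY h.1 h.2
      · exact disjoint_left.1 hXY h.2 h.1⟩⟩
  have hnY : ∀ {v}, v ∈ Y → v ∉ X := fun hv h => disjoint_left.1 hXY h hv
  obtain ⟨P, hFP, hPF, hP, hPmax⟩ := exists_maximal_isLinearForest hF
    (le_sup_left (a := F) (b := GX))
  obtain ⟨Q, hPQ, hQP, hQ, hQmax⟩ := exists_maximal_isLinearForest hP
    (le_sup_left (a := P) (b := B))
  have hPG : P ≤ G := hPF.trans (sup_le hFG fun u v h => h.1)
  have hQG : Q ≤ G := hQP.trans (sup_le hPG fun u v h => by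
    rcases h with h | h
    · exact hjoin u h.1 v h.2
    · exact (hjoin v h.2 u h.1).symm)
  have hPF' : ∀ u v, (u ∉ X ∨ v ∉ X) → (P.Adj u v ↔ F.Adj u v) := by
    refine fun u v h => ⟨fun h' => ?_, fun h' => hFP h'⟩
    rcases hPF h' with h1 | h1
    · exact h1
    · exact (h.elim (· h1.2.1) (· h1.2.2)).elim
  have hQP1 : ∀ u ∈ X, ∀ v ∈ X, (Q.Adj u v ↔ P.Adj u v) := by
    refine fun u hu v hv => ⟨fun h' => ?_, fun h' => hPQ h'⟩
    rcases hQP h' with h1 | h1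
    · exact h1
    · rcases h1 with h1 | h1
      · exact (hnY h1.2 hv).elim
      · exact (hnY h1.1 hu).elim
  have hQP2 : ∀ u ∈ Y, ∀ v, v ∉ X → (Q.Adj u v ↔ F.Adj u v) := by
    refine fun u hu v hv => ⟨fun h' => ?_, fun h' => hPQ (hFP h')⟩
    rcases hQP h' with h1 | h1
    · exact (hPF' u v (Or.inr hv)).1 h1
    · rcases h1 with h1 | h1
      · exact (hnY hu h1.1).elim
      · exact (hv h1.2).elim
  refine (IsLinearForest.hasHamCycle hV hQ hQG (X := X) ?_ hclique).anti (hFP.trans hPQ)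
  by_contra hcon
  push Not at hcon
  obtain ⟨x, hx, hx2⟩ := hcon
  have hw := two_mul_lt_sum_degree hP hr (by omega) hreg (fun u hu v hv huv h1 h2 =>
    hPmax u v (Or.inr ⟨huv, hu, hv⟩) h1 h2)
  set Z := (X ∪ Y)ᶜ with hZ
  have hYZ : Disjoint Y Z := disjoint_left.2 fun v hv hz => by
    rw [hZ, mem_compl] at hz; exact hz (mem_union_right _ hv)
  have hXc : Xᶜ = Y ∪ Z := by
    ext v
    have := @hnY v
    simp only [hZ, mem_compl, mem_union]
    tauto
  have hdeg : ∀ (R : SimpleGraph V) u,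
      R.degree u = nbrsIn R X u + nbrsIn R Y u + nbrsIn R Z u := fun R u => by
    rw [← nbrsIn_add_compl R X u, hXc, nbrsIn_union hYZ, add_assoc]
  have hXZ0 : ∀ R ≤ G, ∀ u ∈ X, nbrsIn R Z u = 0 := fun R hR u hu => by
    rw [nbrsIn, card_eq_zero, eq_empty_iff_forall_notMem]
    intro v hv
    rw [mem_filter, hZ, mem_compl, mem_union, not_or] at hv
    exact hv.1.2 (hXZ u hu v hv.1.1 (hR hv.2))
  have hYlow := card_filter_degree_le_one hQ (x := x) (by omega) (S := Y)
    (disjoint_left.1 hXY hx) (fun v hv hv1 =>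
      hQmax x v (Or.inr (Or.inl ⟨hx, hv⟩)) (by omega) hv1)
  have hYsum : 2 * y ≤ ∑ v ∈ Y, Q.degree v + 1 := by
    have h1 : ∑ v ∈ Y, 2 ≤ ∑ v ∈ Y, (Q.degree v + if Q.degree v ≤ 1 then 1 else 0) := by
      refine sum_le_sum fun v hv => ?_
      split_ifs with h
      · have := degree_pos_of_reachable (hQmax x v (Or.inr (Or.inl ⟨hx, hv⟩)) (by omega) h).symm
          (ne_of_mem_of_not_mem hx (hnY hv)).symm
        omega
      · omega
    rw [sum_add_distrib, ← card_filter, sum_const, hY, smul_eq_mul] at h1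
    omega
  have hXsum : ∑ v ∈ X, Q.degree v < 2 * s := by
    have : ∑ v ∈ X, Q.degree v < ∑ v ∈ X, 2 :=
      sum_lt_sum (fun v _ => (isLinearForest_iff.1 hQ).2 v) ⟨x, hx, hx2⟩
    rw [sum_const, hX, smul_eq_mul] at this
    omega
  have e1 : ∑ v ∈ X, Q.degree v = ∑ v ∈ X, nbrsIn P X v + ∑ v ∈ X, nbrsIn Q Y v := by
    rw [← sum_add_distrib]
    refine sum_congr rfl fun v hv => ?_
    rw [hdeg, hXZ0 Q hQG v hv, nbrsIn_congr (hQP1 v hv), add_zero]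
  have e2 : ∑ v ∈ Y, Q.degree v =
      ∑ v ∈ X, nbrsIn Q Y v + ∑ v ∈ Y, nbrsIn F Y v + ∑ v ∈ Y, nbrsIn F Z v := by
    rw [sum_nbrsIn_comm Q X Y, ← sum_add_distrib, ← sum_add_distrib]
    refine sum_congr rfl fun v hv => ?_
    rw [hdeg, nbrsIn_congr (S := Y) (fun w hw => hQP2 v hv w (hnY hw)),
      nbrsIn_congr (S := Z) (fun w hw => hQP2 v hv w (by
        rw [hZ, mem_compl, mem_union, not_or] at hw; exact hw.1))]
  have e3 : ∑ x ∈ X, (P.degree x + nbrsIn P Xᶜ x) =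
      ∑ v ∈ X, nbrsIn P X v + 2 * ∑ v ∈ X, nbrsIn F Y v := by
    rw [mul_sum, ← sum_add_distrib]
    refine sum_congr rfl fun v hv => ?_
    rw [hdeg, hXc, nbrsIn_union hYZ, hXZ0 P hPG v hv,
      nbrsIn_congr (P := P) (S := Y) (fun w hw => hPF' v w (Or.inr (hnY hw)))]
    ring
  have e4 : ∑ v ∈ X, nbrsIn F Y v + (∑ v ∈ X, nbrsIn F Y v + ∑ v ∈ Y, nbrsIn F Y v +
      ∑ v ∈ Y, nbrsIn F Z v) + ∑ v ∈ Y, nbrsIn F Z v ≤ 2 * k := by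
    calc _ ≤ ∑ v ∈ X, F.degree v + ∑ v ∈ Y, F.degree v + ∑ v ∈ Z, F.degree v := by
          gcongr ?_ + ?_ + ?_
          · exact sum_le_sum fun v _ => by rw [hdeg F v]; omega
          · rw [sum_nbrsIn_comm F X Y, ← sum_add_distrib, ← sum_add_distrib]
            exact sum_le_sum fun v _ => by rw [hdeg F v]
          · rw [sum_nbrsIn_comm F Y Z]
            exact sum_le_sum fun v _ => by rw [hdeg F v]; omega
      _ = ∑ v, F.degree v := by
          rw [← sum_union hXY, ← sum_union (by rw [hZ]; exact disjoint_compl_right), hZ,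
            union_compl]
      _ = 2 * F.edgeFinset.card := F.sum_degrees_eq_twice_card_edges
      _ ≤ 2 * k := by omega
  -- Let a, b, c, d be the ordered counts of P in X, and of F in X–Y, Y–Y, Y–Z. Comparing the degree
  -- sums over Y and X gives c + d - a ≥ 2(y - s) = 2(k - r); with a + 2b ≥ 2r + 1 this yields 2b +
  -- c + d > 2k, against `e4`.
  omega

end Counting

/-! ### Structure of an edge-maximal counterexample. -/

section Structure

open scoped Classical

variable {V : Type*} [Fintype V]

theorem le_degree_of_forall_adj {H : SimpleGraph V} {S : Finset V} {w : V}
    (h : ∀ v ∈ S, H.Adj w v) : S.card ≤ H.degree w := by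
  rw [← card_neighborFinset_eq_degree]
  exact card_le_card fun v hv => (mem_neighborFinset _ _ _).2 (h v hv)

/-- The low-degree set X has bounded size by a crude edge count. Bounded size caps the degrees in X
at |X| + k, and the improved count gives |X| ≤ s; the minimum degree gives the reverse inequality.
-/
theorem exists_clique_of_closed {H : SimpleGraph V} {n s k : ℕ} (hn : Fintype.card V = n)
    (hcl : ∀ u v, u ≠ v → ¬ H.Adj u v → H.degree u + H.degree v < n + k)
    (hδ : ∀ v, s + k ≤ H.degree v) (hsum : n * n ≤ ∑ v, H.degree v + (2 * s + 1) * n)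
    (hlarge : 50 * (s + k + 1) ^ 2 ≤ n) :
    ∃ X Y : Finset V, (∀ u v, u ∉ X → v ∉ X → u ≠ v → H.Adj u v) ∧
      (X = ∅ ∨ X.card = s ∧ Disjoint X Y ∧ (∀ u ∈ X, ∀ v ∈ Y, H.Adj u v) ∧
        (∀ u ∈ X, ∀ v, v ∉ X → H.Adj u v → v ∈ Y) ∧ ∀ u ∈ X, H.degree u = s + k) := by
  set X : Finset V := univ.filter fun v => 2 * H.degree v < n + k with hX
  have hXm : ∀ v, v ∈ X ↔ 2 * H.degree v < n + k := fun v => by simp [hX]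
  have hclique : ∀ u v, u ∉ X → v ∉ X → u ≠ v → H.Adj u v := by
    intro u v hu hv huv
    by_contra hcon
    have := hcl u v huv hcon
    rw [hXm] at hu hv
    omega
  obtain ⟨b, hb⟩ : ∃ b, X.card = b := ⟨_, rfl⟩
  have hbc : Xᶜ.card + b = n := by
    rw [← hb, ← hn, add_comm]; exact card_add_card_compl X
  have hsplit : ∑ v, H.degree v = ∑ v ∈ X, H.degree v + ∑ v ∈ Xᶜ, H.degree v :=
    (sum_add_sum_compl X _).symm
  have hb4 : b ≤ 4 * s := by
    have h1 : 2 * ∑ v ∈ X, H.degree v + b ≤ b * (n + k) := by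
      rw [mul_sum, ← hb]
      have : ∑ v ∈ X, (2 * H.degree v + 1) ≤ ∑ v ∈ X, (n + k) :=
        sum_le_sum fun v hv => (hXm v).1 hv
      rwa [sum_add_distrib, sum_const, sum_const, smul_eq_mul, smul_eq_mul, mul_one] at this
    have h2 : ∑ v ∈ Xᶜ, H.degree v + Xᶜ.card ≤ Xᶜ.card * n := by
      have : ∑ v ∈ Xᶜ, (H.degree v + 1) ≤ ∑ v ∈ Xᶜ, n :=
        sum_le_sum fun v hv => by rw [← hn]; exact H.degree_lt_card_verts v
      rwa [sum_add_distrib, sum_const, sum_const, smul_eq_mul, smul_eq_mul, mul_one] at this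
    by_contra hcon
    push Not at hcon
    obtain ⟨c, rfl⟩ := Nat.exists_eq_add_of_lt hcon
    zify at *
    have hc : (Xᶜ.card : ℤ) = n - (4 * s + c + 1) := by linarith
    rw [hc] at h2
    have hnk : (0 : ℤ) ≤ n - 1 - k := by nlinarith
    have := mul_nonneg (Int.natCast_nonneg c) hnk
    nlinarith
  have hCdeg : ∀ w, w ∉ X → n ≤ H.degree w + b + 1 := by
    intro w hw
    have := le_degree_of_forall_adj (H := H) (S := Xᶜ.erase w) (w := w) fun v hv => by
      rw [mem_erase, mem_compl] at hv
      exact hclique w v hw hv.2 hv.1.symm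
    rw [card_erase_of_mem (mem_compl.2 hw)] at this
    omega
  have hXdeg : ∀ x ∈ X, H.degree x ≤ b + k := by
    intro x hx
    obtain ⟨w, hw, hxw⟩ : ∃ w, w ∉ X ∧ ¬ H.Adj x w := by
      by_contra hcon
      push Not at hcon
      have h1 := le_degree_of_forall_adj (H := H) (S := Xᶜ) (w := x) fun v hv =>
        hcon v (mem_compl.1 hv)
      have h2 := (hXm x).1 hx
      nlinarith
    have h1 := hcl x w (ne_of_mem_of_not_mem hx hw) hxw
    have h2 := hCdeg w hw
    omega
  have hbs : b ≤ s := by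
    have h1 : ∑ v ∈ X, H.degree v ≤ b * (b + k) := by
      rw [← hb, ← smul_eq_mul]
      exact sum_le_card_nsmul _ _ _ (by rw [hb]; exact hXdeg)
    have h2 : ∑ v ∈ Xᶜ, H.degree v + Xᶜ.card ≤ Xᶜ.card * Xᶜ.card + b * (b + k) := by
      have h3 : ∑ v ∈ Xᶜ, H.degree v = ∑ v ∈ Xᶜ, nbrsIn H Xᶜ v + ∑ v ∈ X, nbrsIn H Xᶜ v := by
        rw [sum_nbrsIn_comm H X Xᶜ, ← sum_add_distrib]
        exact sum_congr rfl fun v _ => by rw [← nbrsIn_add_compl H X v, add_comm]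
      have h4 : ∑ v ∈ X, nbrsIn H Xᶜ v ≤ ∑ v ∈ X, H.degree v :=
        sum_le_sum fun v _ => by rw [← nbrsIn_add_compl H X v]; omega
      have h5 : ∑ v ∈ Xᶜ, (nbrsIn H Xᶜ v + 1) ≤ ∑ v ∈ Xᶜ, Xᶜ.card := by
        refine sum_le_sum fun v hv => ?_
        refine card_lt_card (filter_ssubset.2 ⟨v, hv, H.irrefl⟩)
      rw [sum_add_distrib, sum_const, sum_const, smul_eq_mul, smul_eq_mul, mul_one] at h5
      omega
    by_contra hcon
    push Not at hcon
    zify at *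
    have hc : (Xᶜ.card : ℤ) = n - b := by linarith
    rw [hc] at h2
    have hk0 := Int.natCast_nonneg k
    have h6 : (0 : ℤ) ≤ (b - s - 1) * n := mul_nonneg (by linarith) (Int.natCast_nonneg n)
    have h7 : (b : ℤ) * b ≤ 4 * s * (4 * s) := by gcongr
    have h8 : (b : ℤ) * k ≤ 4 * s * k := by gcongr
    nlinarith
  rcases X.eq_empty_or_nonempty with h0 | ⟨x₀, hx₀⟩
  · exact ⟨X, ∅, hclique, Or.inl h0⟩
  have hbs' : b = s := by
    have := hXdeg x₀ hx₀
    have := hδ x₀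
    omega
  subst hbs'
  have hXdeg' : ∀ x ∈ X, H.degree x = b + k := fun x hx => le_antisymm (hXdeg x hx) (hδ x)
  -- A vertex outside X with a neighbour in X has degree at least n - s, so missing some u in X, of
  -- degree s + k, would reach the forbidden sum n + k.
  refine ⟨X, Xᶜ.filter fun w => ∃ x ∈ X, H.Adj x w, hclique, Or.inr ⟨hb, ?_, ?_, ?_, hXdeg'⟩⟩
  · exact disjoint_left.2 fun v hv hv' => by
      rw [mem_filter, mem_compl] at hv'
      exact hv'.1 hv
  · intro u hu w hw
    rw [mem_filter, mem_compl] at hw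
    obtain ⟨hwX, x, hx, hxw⟩ := hw
    by_contra hcon
    have h1 := hcl u w (ne_of_mem_of_not_mem hu hwX) hcon
    have h2 := le_degree_of_forall_adj (H := H) (S := insert x (Xᶜ.erase w)) (w := w)
      fun v hv => by
        rw [mem_insert, mem_erase, mem_compl] at hv
        rcases hv with rfl | hv
        · exact hxw.symm
        · exact hclique w v hwX hv.2 hv.1.symm
    rw [card_insert_of_notMem (by simp [hx]), card_erase_of_mem (mem_compl.2 hwX)] at h2
    have := hXdeg' u hu
    omega
  · intro u hu v hv huv
    rw [mem_filter, mem_compl]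
    exact ⟨hv, u, hu, huv⟩

theorem exists_structure {G F : SimpleGraph V} {n s k : ℕ} (hn : Fintype.card V = n)
    (hδ : ∀ v, s + k ≤ G.degree v) (hsum : n * n ≤ ∑ v, G.degree v + (2 * s + 1) * n)
    (hlarge : 50 * (s + k + 1) ^ 2 ≤ n) (hF : IsLinearForest F) (hFG : F ≤ G)
    (hFk : F.edgeFinset.card ≤ k) (hham : ¬ HasHamCycle G F) :
    ∃ X Y : Finset V, X.card = s ∧ Disjoint X Y ∧ (∀ u ∈ X, ∀ v ∈ Y, G.Adj u v) ∧
      (∀ u ∈ X, ∀ v, v ∉ X → G.Adj u v → v ∈ Y) ∧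
      (Y.card = s + k ∧ (∀ u ∈ X, ∀ v ∈ X, ¬ G.Adj u v) ∨
        Y.card = k + 1 ∧ ∀ u ∈ X, ∀ v ∈ X, u ≠ v → G.Adj u v) := by
  have hV : 3 ≤ Fintype.card V := by nlinarith
  obtain ⟨H, hGH, hH⟩ := (Set.toFinite {H | G ≤ H ∧ ¬ HasHamCycle H F}).exists_le_maximal
    (a := G) ⟨le_rfl, hham⟩
  have hHham := hH.1.2
  have hcl : ∀ u v, u ≠ v → ¬ H.Adj u v → H.degree u + H.degree v < n + k := by
    intro u v huv hnadj
    rw [← hn]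
    refine degree_add_degree_lt hV hFk ?_ hHham
    refine HasHamCycle.hasHamPath huv (hFG.trans hGH) hnadj ?_ hHham
    by_contra hcon
    have : H ⊔ edge u v ≤ H := hH.2 ⟨hGH.trans le_sup_left, hcon⟩ le_sup_left
    exact hnadj (this (by rw [sup_adj, edge_adj]; exact Or.inr ⟨Or.inl ⟨rfl, rfl⟩, huv⟩))
  have hdeg : ∀ v, G.degree v ≤ H.degree v := fun v => degree_le_of_le hGH
  obtain ⟨X, Y, hclique, hXY⟩ := exists_clique_of_closed hn hcl (fun v => (hδ v).trans (hdeg v))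
    (hsum.trans (Nat.add_le_add_right (sum_le_sum fun v _ => hdeg v) _)) hlarge
  rcases hXY with rfl | ⟨hX, hXY, hjoin, hXZ, hXdeg⟩
  · exact (hHham (hF.hasHamCycle hV (hFG.trans hGH) (X := ∅) (by simp) hclique)).elim
  -- On X the degree in H equals the lower bound for the degree in G, so no edge at X was added.
  have hadj : ∀ u ∈ X, ∀ v, G.Adj u v ↔ H.Adj u v := by
    intro u hu v
    have hsub : G.neighborFinset u ⊆ H.neighborFinset u := fun w hw => by
      rw [mem_neighborFinset] at hw ⊢
      exact hGH hw
    have := eq_of_subset_of_card_le hsub (by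
      rw [card_neighborFinset_eq_degree, card_neighborFinset_eq_degree, hXdeg u hu]; exact hδ u)
    rw [← mem_neighborFinset, this, mem_neighborFinset]
  refine ⟨X, Y, hX, hXY, fun u hu v hv => (hadj u hu v).2 (hjoin u hu v hv),
    fun u hu v hv h => hXZ u hu v hv ((hadj u hu v).1 h), ?_⟩
  have hreg : ∀ x ∈ X, Y.card + nbrsIn H X x = s + k := by
    intro x hx
    rw [← hXdeg x hx, ← nbrsIn_add_compl H X x, add_comm]
    congr 1
    rw [← nbrsIn_eq_of_subset (S := Y) (fun v hv => mem_compl.2 (disjoint_right.1 hXY hv))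
      (fun v hv h => hXZ x hx v (mem_compl.1 hv) h), nbrsIn, filter_true_of_mem (hjoin x hx)]
  have hlt : ∀ x ∈ X, nbrsIn H X x < s := fun x hx => by
    rw [← hX]
    exact card_lt_card (filter_ssubset.2 ⟨x, hx, H.irrefl⟩)
  rcases X.eq_empty_or_nonempty with rfl | ⟨x₀, hx₀⟩
  · exact (hHham (hF.hasHamCycle hV (hFG.trans hGH) (X := ∅) (by simp) hclique)).elim
  have h0 := hreg x₀ hx₀
  have h0' := hlt x₀ hx₀
  rcases Nat.eq_zero_or_pos (nbrsIn H X x₀) with hr | hr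
  · left
    refine ⟨by omega, fun u hu v hv huv => ?_⟩
    have h1 := hreg u hu
    have h2 : nbrsIn H X u = 0 := by omega
    rw [nbrsIn, card_eq_zero, filter_eq_empty_iff] at h2
    exact h2 hv ((hadj u hu v).1 huv)
  by_cases hr2 : nbrsIn H X x₀ + 2 ≤ s
  · exact (hHham (hasHamCycle_of_regular hV hF (hFG.trans hGH) hFk hXY hX rfl h0 hr hr2 hclique
      hjoin hXZ fun x hx => by have := hreg x hx; omega)).elim
  · right
    refine ⟨by omega, fun u hu v hv huv => ?_⟩
    have h1 := hreg u hu
    have h2 : X.filter (fun w => H.Adj u w) = X.erase u := by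
      refine eq_of_subset_of_card_le (fun w hw => ?_) ?_
      · rw [mem_filter] at hw
        exact mem_erase.2 ⟨hw.2.ne', hw.1⟩
      · rw [card_erase_of_mem hu, hX]
        change s - 1 ≤ nbrsIn H X u
        omega
    have h3 : v ∈ X.filter (fun w => H.Adj u w) := by rw [h2]; exact mem_erase.2 ⟨huv.symm, hv⟩
    exact (hadj u hu v).2 (mem_filter.1 h3).2

end Structure

/-! ### Merris' bound and the Rayleigh quotient. -/

section Spectral

open scoped Classical

variable {V : Type*} [Fintype V]

theorem exists_signlessRadius_eigenvector [DecidableEq V] [Nonempty V] (G : SimpleGraph V)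
    [DecidableRel G.Adj] : ∃ x : V → ℝ, x ≠ 0 ∧ ∀ u, signlessRadius G * x u =
      ∑ v ∈ G.neighborFinset u, (x u + x v) := by
  have h := (isGreatest_signlessRadius G).1
  rw [← Matrix.spectrum_toLin', ← Module.End.hasEigenvalue_iff_mem_spectrum] at h
  obtain ⟨x, hx⟩ := h.exists_hasEigenvector
  refine ⟨x, hx.2, fun u => ?_⟩
  have := congrFun hx.apply_eq_smul u
  rw [Matrix.toLin'_apply, signlessLaplacian, Matrix.add_mulVec, Pi.add_apply,
    degMatrix_mulVec_apply, adjMatrix_mulVec_apply, Pi.smul_apply, smul_eq_mul] at this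
  rw [← this, sum_add_distrib, sum_const, nsmul_eq_mul, card_neighborFinset_eq_degree]

/-- Merris' bound. -/
theorem exists_mul_degree_le {G : SimpleGraph V} {q : ℝ} {x : V → ℝ} (hx0 : x ≠ 0)
    (hx : ∀ u, q * x u = ∑ v ∈ G.neighborFinset u, (x u + x v)) (hδ : ∀ v, 0 < G.degree v) :
    ∃ u, q * G.degree u ≤ G.degree u ^ 2 + ∑ v ∈ G.neighborFinset u, (G.degree v : ℝ) := by
  obtain ⟨w, hw⟩ := Function.ne_iff.1 hx0
  -- Weighting by degrees bounds q by a row sum of D⁻¹QD.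
  obtain ⟨u, -, hu⟩ := exists_max_image univ (fun v => |x v| / G.degree v) ⟨w, mem_univ w⟩
  have hd : ∀ v, (0 : ℝ) < G.degree v := fun v => by exact_mod_cast hδ v
  refine ⟨u, ?_⟩
  have hpos : 0 < |x u| / G.degree u :=
    (div_pos (abs_pos.2 hw) (hd w)).trans_le (hu w (mem_univ w))
  set t := |x u| / G.degree u with ht
  have hxu : |x u| = t * G.degree u := by rw [ht, div_mul_cancel₀ _ (hd u).ne']
  have hxv : ∀ v, |x v| ≤ t * G.degree v := fun v => by
    have := hu v (mem_univ v)
    rwa [div_le_iff₀ (hd v)] at this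
  have h1 : q * |x u| ≤ ∑ v ∈ G.neighborFinset u, (t * G.degree u + t * G.degree v) := by
    calc q * |x u| ≤ |q * x u| := by
          rw [abs_mul]; exact mul_le_mul_of_nonneg_right (le_abs_self q) (abs_nonneg _)
      _ ≤ ∑ v ∈ G.neighborFinset u, |x u + x v| := by rw [hx u]; exact abs_sum_le_sum_abs _ _
      _ ≤ _ := sum_le_sum fun v _ => (abs_add_le _ _).trans (add_le_add (hxv u) (hxv v))
  rw [sum_add_distrib, sum_const, card_neighborFinset_eq_degree, nsmul_eq_mul, ← mul_sum, hxu] at h1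
  refine le_of_mul_le_mul_left ?_ hpos
  calc _ = q * (t * G.degree u) := by ring
    _ ≤ _ := h1
    _ = _ := by ring

/-- At Merris' vertex u, of degree d, the degree sum is at least d(2n - 2s - 1 - d). As n - 2s - 1 ≤
d ≤ n, concavity puts this above its value n(n - 2s - 1) at both ends. -/
theorem sum_degree_lower_bound {G : SimpleGraph V} {n s : ℕ} (hn : Fintype.card V = n) {q : ℝ}
    {x : V → ℝ} (hx0 : x ≠ 0)
    (hx : ∀ u, q * x u = ∑ v ∈ G.neighborFinset u, (x u + x v)) (hδ : ∀ v, 0 < G.degree v)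
    (hq : 2 * ((n : ℝ) - s - 1) ≤ q) : n * n ≤ ∑ v, G.degree v + (2 * s + 1) * n := by
  obtain ⟨u, hu⟩ := exists_mul_degree_le hx0 hx hδ
  have hlt : ∀ v, (G.degree v : ℝ) + 1 ≤ n := fun v => by
    rw [← hn]; exact_mod_cast G.degree_lt_card_verts v
  have hd : (0 : ℝ) < G.degree u := by exact_mod_cast hδ u
  have h1 : ∑ v ∈ G.neighborFinset u, (G.degree v : ℝ) ≤ G.degree u * (n - 1) := by
    rw [← card_neighborFinset_eq_degree G u, ← nsmul_eq_mul]
    exact sum_le_card_nsmul _ _ _ fun v _ => by linarith [hlt v]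
  have h2 : (G.degree u : ℝ) + ∑ v ∈ G.neighborFinset u, (G.degree v : ℝ) ≤
      ∑ v, (G.degree v : ℝ) := by
    have := sum_insert (s := G.neighborFinset u) (a := u) (f := fun v => (G.degree v : ℝ))
      (by simp)
    rw [← this]
    exact sum_le_sum_of_subset_of_nonneg (subset_univ _) fun _ _ _ => by positivity
  have h3 : q ≤ G.degree u + (n - 1) := by
    refine le_of_mul_le_mul_right ?_ hd
    nlinarith
  have h4 := hlt u
  have h5 : (0 : ℝ) ≤ (n - G.degree u) * (G.degree u - (n - 2 * s - 1)) :=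
    mul_nonneg (by linarith) (by linarith)
  have h6 : (n : ℝ) * n ≤ ∑ v, (G.degree v : ℝ) + (2 * s + 1) * n := by
    nlinarith [mul_le_mul_of_nonneg_right hq hd.le]
  exact_mod_cast h6

theorem two_mul_rayleigh {G : SimpleGraph V} {q : ℝ} {x : V → ℝ}
    (hx : ∀ u, q * x u = ∑ v ∈ G.neighborFinset u, (x u + x v)) :
    2 * (q * ∑ u, x u ^ 2) = ∑ u, ∑ v, if G.Adj u v then (x u + x v) ^ 2 else 0 := by
  have h1 : q * ∑ u, x u ^ 2 = ∑ u, ∑ v, if G.Adj u v then x u * (x u + x v) else 0 := by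
    rw [mul_sum]
    refine sum_congr rfl fun u _ => ?_
    rw [← sum_filter, ← neighborFinset_eq_filter, ← mul_sum, ← hx u]
    ring
  have h2 : q * ∑ u, x u ^ 2 = ∑ u, ∑ v, if G.Adj u v then x v * (x u + x v) else 0 := by
    rw [h1, sum_comm]
    refine sum_congr rfl fun u _ => sum_congr rfl fun v _ => ?_
    simp only [G.adj_comm u v, add_comm]
  rw [two_mul]
  nth_rewrite 1 [h1]
  rw [h2, ← sum_add_distrib]
  refine sum_congr rfl fun u _ => ?_
  rw [← sum_add_distrib]
  refine sum_congr rfl fun v _ => ?_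
  split_ifs <;> ring

omit [Fintype V] in
theorem nbrsIn_add_nbrsIn_compl {G : SimpleGraph V} {W : Finset V} {w : V} (hw : w ∈ W) :
    nbrsIn G W w + nbrsIn Gᶜ W w + 1 = W.card := by
  obtain ⟨K, hK⟩ : ∃ K, K = Gᶜ := ⟨_, rfl⟩
  have hKadj : ∀ u v, K.Adj u v ↔ u ≠ v ∧ ¬ G.Adj u v := fun u v => by rw [hK, compl_adj]
  rw [← hK]
  unfold nbrsIn
  rw [← card_erase_add_one hw, ← card_union_of_disjoint]
  · congr 2
    ext v
    simp only [mem_union, mem_filter, mem_erase, hKadj]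
    constructor
    · rintro (⟨h1, h2⟩ | ⟨h1, h2⟩)
      · exact ⟨h2.ne', h1⟩
      · exact ⟨h2.1.symm, h1⟩
    · rintro ⟨h1, h2⟩
      by_cases h : G.Adj w v
      · exact Or.inl ⟨h2, h⟩
      · exact Or.inr ⟨h2, h1.symm, h⟩
  · refine disjoint_left.2 fun v h1 h2 => ?_
    rw [mem_filter] at h1 h2
    exact ((hKadj _ _).1 h2.2).2 h1.2

omit [Fintype V] in
theorem nbrsIn_le_card (G : SimpleGraph V) (W : Finset V) (w : V) : nbrsIn G W w ≤ W.card :=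
  card_filter_le _ _

/-- The number of ordered non-adjacent pairs outside `X` is bounded. -/
theorem sum_nbrsIn_compl_le {G : SimpleGraph V} {n s y : ℕ} {X Y : Finset V}
    (hn : Fintype.card V = n) (hX : X.card = s) (hY : Y.card = y)
    (hXY : ∀ u ∈ X, ∀ v, v ∉ X → G.Adj u v → v ∈ Y)
    (hsum : n * n ≤ ∑ v, G.degree v + (2 * s + 1) * n) :
    ∑ w ∈ Xᶜ, nbrsIn Gᶜ Xᶜ w ≤ 2 * s * s + 2 * s * y + s := by
  have hm : Xᶜ.card + s = n := by rw [← hX, ← hn, add_comm]; exact card_add_card_compl X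
  have h1 : ∑ v ∈ X, nbrsIn G Xᶜ v ≤ s * y := by
    rw [← hX, ← smul_eq_mul]
    refine sum_le_card_nsmul _ _ _ fun v hv => ?_
    rw [← hY]
    refine card_le_card fun w hw => ?_
    rw [mem_filter, mem_compl] at hw
    exact hXY v hv w hw.1 hw.2
  have h2 : ∑ v ∈ X, nbrsIn G X v ≤ s * s := by
    nth_rewrite 1 [← hX]
    rw [← smul_eq_mul]
    refine sum_le_card_nsmul _ _ _ fun v hv => ?_
    rw [← hX]
    exact nbrsIn_le_card _ _ _
  have h3 : ∑ v, G.degree v = ∑ v ∈ X, nbrsIn G X v + ∑ v ∈ X, nbrsIn G Xᶜ v +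
      (∑ v ∈ X, nbrsIn G Xᶜ v + ∑ v ∈ Xᶜ, nbrsIn G Xᶜ v) := by
    rw [← sum_add_sum_compl X, ← sum_add_distrib, sum_nbrsIn_comm G X Xᶜ, ← sum_add_distrib]
    congr 1 <;> exact sum_congr rfl fun v _ => (nbrsIn_add_compl G X v).symm
  have h4 : ∑ v ∈ Xᶜ, nbrsIn G Xᶜ v + ∑ w ∈ Xᶜ, nbrsIn Gᶜ Xᶜ w + Xᶜ.card =
      Xᶜ.card * Xᶜ.card := by
    have := sum_congr rfl fun v (hv : v ∈ Xᶜ) => nbrsIn_add_nbrsIn_compl (G := G) hv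
    simpa only [sum_add_distrib, sum_const, smul_eq_mul, mul_one] using this
  zify at *
  have hm' : (Xᶜ.card : ℤ) = n - s := by linarith
  rw [hm'] at h4
  nlinarith

/-- If `x` is nearly constant off `X` and nearly zero on `X`, the Rayleigh quotient bounds the
number of non-adjacent pairs off `X`. -/
theorem mul_sum_nbrsIn_compl_le_of_rayleigh {G : SimpleGraph V} {n s y : ℕ} {X Y : Finset V} {q : ℝ}
    {x : V → ℝ} {η : ℝ} (hn : Fintype.card V = n) (hX : X.card = s) (hY : Y.card = y)
    (hXY : ∀ u ∈ X, ∀ v, v ∉ X → G.Adj u v → v ∈ Y)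
    (hx : ∀ u, q * x u = ∑ v ∈ G.neighborFinset u, (x u + x v))
    (hq : 2 * ((n : ℝ) - s - 1) ≤ q) (hns : s + 1 ≤ n) (hη1 : η ≤ 1)
    (hW : ∀ w, w ∉ X → 1 - η ≤ x w) (hW1 : ∀ w, |x w| ≤ 1) (hxX : ∀ v ∈ X, |x v| ≤ η) :
    (4 * (1 - η) ^ 2) * (∑ w ∈ Xᶜ, nbrsIn Gᶜ Xᶜ w : ℕ) ≤
      2 * (s * y * (1 + η) ^ 2) + s * s * (4 * η ^ 2) := by
  obtain ⟨K, hK⟩ : ∃ K, K = Gᶜ := ⟨_, rfl⟩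
  have hKadj : ∀ u v, K.Adj u v ↔ u ≠ v ∧ ¬ G.Adj u v := fun u v => by rw [hK, compl_adj]
  rw [← hK]
  have hm : (Xᶜ.card : ℝ) = n - s := by
    rw [← hX, ← hn, eq_sub_iff_add_eq, add_comm]
    exact_mod_cast card_add_card_compl X
  have hns' : (s : ℝ) + 1 ≤ n := by exact_mod_cast hns
  set f : V → V → ℝ := fun u v => if G.Adj u v then (x u + x v) ^ 2 else 0 with hf
  have hfs : ∀ u v, f u v = f v u := fun u v => by
    simp only [hf, G.adj_comm u v, add_comm]
  have hsplit : ∑ u, ∑ v, f u v = ∑ u ∈ X, ∑ v ∈ X, f u v + 2 * ∑ u ∈ X, ∑ v ∈ Xᶜ, f u v +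
      ∑ u ∈ Xᶜ, ∑ v ∈ Xᶜ, f u v := by
    have hc : ∑ u ∈ Xᶜ, ∑ v ∈ X, f u v = ∑ u ∈ X, ∑ v ∈ Xᶜ, f u v := by
      rw [sum_comm]
      exact sum_congr rfl fun u _ => sum_congr rfl fun v _ => hfs v u
    rw [← sum_add_sum_compl X]
    simp_rw [← sum_add_sum_compl X (fun v => f _ v), sum_add_distrib]
    rw [hc]
    ring
  have hXX : ∑ u ∈ X, ∑ v ∈ X, f u v ≤ s * s * (4 * η ^ 2) := by
    have : ∀ u ∈ X, ∑ v ∈ X, f u v ≤ s * (4 * η ^ 2) := fun u hu => by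
      rw [← hX, ← nsmul_eq_mul]
      refine sum_le_card_nsmul _ _ _ fun v hv => ?_
      have h1 := hxX u hu
      have h2 := hxX v hv
      simp only [hf]
      split_ifs
      · have : |x u + x v| ≤ 2 * η := (abs_add_le _ _).trans (by linarith)
        have := sq_le_sq' (abs_le.1 this).1 (abs_le.1 this).2
        linarith
      · positivity
    have h := sum_le_card_nsmul _ _ _ this
    rw [hX, nsmul_eq_mul] at h
    linarith
  have hXW : ∑ u ∈ X, ∑ v ∈ Xᶜ, f u v ≤ s * y * (1 + η) ^ 2 := by
    have : ∀ u ∈ X, ∑ v ∈ Xᶜ, f u v ≤ y * (1 + η) ^ 2 := fun u hu => by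
      calc ∑ v ∈ Xᶜ, f u v = ∑ v ∈ Xᶜ.filter (fun v => G.Adj u v), (x u + x v) ^ 2 := by
            rw [sum_filter]
        _ ≤ ∑ v ∈ Y, (x u + x v) ^ 2 := by
            refine sum_le_sum_of_subset_of_nonneg (fun v hv => ?_) fun _ _ _ => by positivity
            rw [mem_filter, mem_compl] at hv
            exact hXY u hu v hv.1 hv.2
        _ ≤ y * (1 + η) ^ 2 := by
            rw [← hY, ← nsmul_eq_mul]
            refine sum_le_card_nsmul _ _ _ fun v hv => ?_
            have h1 := hxX u hu
            have h2 := hW1 v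
            have : |x u + x v| ≤ 1 + η := (abs_add_le _ _).trans (by linarith)
            exact sq_le_sq' (abs_le.1 this).1 (abs_le.1 this).2
    have h := sum_le_card_nsmul _ _ _ this
    rw [hX, nsmul_eq_mul] at h
    linarith
  -- Cauchy–Schwarz gives the complete graph's bound off X; each missing ordered pair takes away at
  -- least 4(1 - η)².
  have hWW : ∑ u ∈ Xᶜ, ∑ v ∈ Xᶜ, f u v + (4 * (1 - η) ^ 2) * (∑ w ∈ Xᶜ, nbrsIn K Xᶜ w : ℕ) ≤
      4 * (n - s - 1) * ∑ u ∈ Xᶜ, x u ^ 2 := by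
    have h1 : ∀ u ∈ Xᶜ, ∑ v ∈ Xᶜ, f u v + (4 * (1 - η) ^ 2) * (nbrsIn K Xᶜ u : ℕ) ≤
        ∑ v ∈ Xᶜ, (x u + x v) ^ 2 - 4 * x u ^ 2 := by
      intro u hu
      have hu' := mem_compl.1 hu
      calc ∑ v ∈ Xᶜ, f u v + (4 * (1 - η) ^ 2) * (nbrsIn K Xᶜ u : ℕ)
          = ∑ v ∈ Xᶜ, (f u v + if K.Adj u v then 4 * (1 - η) ^ 2 else 0) := by
            rw [sum_add_distrib, ← sum_filter (p := fun v => K.Adj u v), sum_const, nsmul_eq_mul, nbrsIn]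
            ring
        _ ≤ ∑ v ∈ Xᶜ, ((x u + x v) ^ 2 - if u = v then 4 * x u ^ 2 else 0) := by
            refine sum_le_sum fun v hv => ?_
            have hv' := mem_compl.1 hv
            simp only [hf, hKadj]
            by_cases huv : u = v
            · subst huv
              simp only [G.irrefl, if_false, ne_eq, not_true, false_and, if_true]
              linarith
            · by_cases hadj : G.Adj u v
              · simp [huv, hadj]
              · simp only [hadj, huv, if_false, ne_eq, not_false_eq_true, and_self, if_true]
                have := pow_le_pow_left₀ (by linarith) (add_le_add (hW u hu') (hW v hv')) 2
                linarith
        _ = _ := by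
            rw [sum_sub_distrib, sum_ite_eq, if_pos hu]
    have h2 := sum_le_sum h1
    rw [sum_add_distrib, ← mul_sum, sum_sub_distrib, ← mul_sum] at h2
    have h3 : ∑ u ∈ Xᶜ, ∑ v ∈ Xᶜ, (x u + x v) ^ 2 =
        2 * (n - s) * ∑ u ∈ Xᶜ, x u ^ 2 + 2 * (∑ u ∈ Xᶜ, x u) ^ 2 := by
      have h4 : ∀ u v, (x u + x v) ^ 2 = x u ^ 2 + 2 * (x u * x v) + x v ^ 2 := fun u v => by ring
      simp_rw [h4, sum_add_distrib, sum_const, ← mul_sum, ← sum_mul, nsmul_eq_mul, hm]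
      rw [← mul_sum]
      ring
    have h5 := sq_sum_le_card_mul_sum_sq (s := Xᶜ) (f := x)
    rw [hm] at h5
    push_cast
    linarith
  have hray := two_mul_rayleigh hx
  change _ = ∑ u, ∑ v, f u v at hray
  rw [hsplit] at hray
  have h0 : ∑ u, x u ^ 2 = ∑ u ∈ X, x u ^ 2 + ∑ u ∈ Xᶜ, x u ^ 2 := (sum_add_sum_compl X _).symm
  have h6 : 0 ≤ ∑ u ∈ X, x u ^ 2 := sum_nonneg fun _ _ => by positivity
  have h7 : 0 ≤ ∑ u, x u ^ 2 := sum_nonneg fun _ _ => by positivity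
  have h8 := mul_le_mul_of_nonneg_right hq h7
  have h9 : 0 ≤ ((n : ℝ) - s - 1) * ∑ u ∈ X, x u ^ 2 := mul_nonneg (by linarith) h6
  rw [h0] at h8 hray
  linarith

end Spectral

/-! ### Eigenvector estimates and the sharp count of missing edges. -/

section Spectral

open scoped Classical

variable {V : Type*} [Fintype V]

/-- An eigenvector to a large eigenvalue, scaled to have maximum `1`, is nearly constant off `X`
and nearly zero on `X`. -/
theorem eigenvector_estimates {G : SimpleGraph V} {n s y T : ℕ} {X : Finset V} {q : ℝ}
    {x : V → ℝ} (hn : Fintype.card V = n) (hX : X.card = s)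
    (hdX : ∀ v ∈ X, G.degree v ≤ s + y)
    (hT : ∀ w ∈ Xᶜ, nbrsIn Gᶜ Xᶜ w ≤ T)
    (hx : ∀ u, q * x u = ∑ v ∈ G.neighborFinset u, (x u + x v))
    (hq : 2 * ((n : ℝ) - s - 1) ≤ q) (hns : 2 * s + y + 1 < n)
    (hx1 : ∀ v, |x v| ≤ 1) {u : V} (hu : x u = 1) :
    (∀ w, w ∉ X → (1 - x w) * (n - 1 - 2 * s - y) ≤ 7 * s + 4 * T + 2 + y) ∧
      ∀ v ∈ X, |x v| * (n - 1 - 2 * s - y) ≤ 7 * s + 4 * T + 2 + y := by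
  have hns' : 2 * (s : ℝ) + y + 1 < n := by exact_mod_cast hns
  have hs0 : (0 : ℝ) ≤ s := Nat.cast_nonneg s
  have hy0 : (0 : ℝ) ≤ y := Nat.cast_nonneg y
  have hT0 : (0 : ℝ) ≤ T := Nat.cast_nonneg T
  have hm : (Xᶜ.card : ℝ) = n - s := by
    rw [← hX, ← hn, eq_sub_iff_add_eq, add_comm]
    exact_mod_cast card_add_card_compl X
  have hle : ∀ v, x v ≤ 1 := fun v => (abs_le.1 (hx1 v)).2
  have hge : ∀ v, -1 ≤ x v := fun v => (abs_le.1 (hx1 v)).1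
  have hx' : ∀ w, (q - G.degree w) * x w = ∑ v ∈ G.neighborFinset w, x v := fun w => by
    have := hx w
    rw [sum_add_distrib, sum_const, card_neighborFinset_eq_degree, nsmul_eq_mul] at this
    linarith
  -- The defect 1 - x is nonnegative. At u, where x = 1, its sum over neighbours is 2d(u) - q ≤ 2s,
  -- so the total defect off X is bounded independently of n.
  have hdefect : ∀ w, ∑ v ∈ G.neighborFinset w, (1 - x v) =
      G.degree w - (q - G.degree w) * x w := fun w => by
    rw [sum_sub_distrib, sum_const, card_neighborFinset_eq_degree, nsmul_eq_mul, hx', mul_one]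
  have hqu : q ≤ 2 * G.degree u := by
    have h1 := hdefect u
    have h2 : 0 ≤ ∑ v ∈ G.neighborFinset u, (1 - x v) := sum_nonneg fun v _ => by linarith [hle v]
    rw [h1, hu] at h2
    linarith
  have huX : u ∉ X := fun h => by
    have : (G.degree u : ℝ) ≤ s + y := by exact_mod_cast hdX u h
    linarith
  have hdeg : ∀ w, w ∉ X → (n : ℝ) - s - 1 - T ≤ G.degree w ∧
      (G.degree w : ℝ) ≤ n - s - 1 + s := fun w hw => by
    have h1 := nbrsIn_add_nbrsIn_compl (G := G) (mem_compl.2 hw)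
    have h2 := nbrsIn_add_compl G X w
    have h3 := nbrsIn_le_card G X w
    have h4 := hT w (mem_compl.2 hw)
    rw [hX] at h3
    have h1' : (nbrsIn G Xᶜ w : ℝ) + nbrsIn Gᶜ Xᶜ w + 1 = n - s := by
      rw [← hm]; exact_mod_cast h1
    have h2' : (nbrsIn G X w : ℝ) + nbrsIn G Xᶜ w = G.degree w := by exact_mod_cast h2
    have h3' : (nbrsIn G X w : ℝ) ≤ s := by exact_mod_cast h3
    have h4' : (nbrsIn Gᶜ Xᶜ w : ℝ) ≤ T := by exact_mod_cast h4
    have h5 : (0 : ℝ) ≤ nbrsIn G X w := Nat.cast_nonneg _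
    have h6 : (0 : ℝ) ≤ nbrsIn Gᶜ Xᶜ w := Nat.cast_nonneg _
    constructor <;> linarith
  have hWsum : ∑ v ∈ Xᶜ, (1 - x v) ≤ 2 * s + 2 * (1 + T) := by
    have h1 : ∑ v ∈ Xᶜ \ G.neighborFinset u, (1 - x v) ≤ 2 * (1 + T) := by
      have hc : (Xᶜ \ G.neighborFinset u).card ≤ 1 + T := by
        have h2 := nbrsIn_add_nbrsIn_compl (G := G) (mem_compl.2 huX)
        have h3 := hT u (mem_compl.2 huX)
        have h4 := card_sdiff_add_card_inter Xᶜ (G.neighborFinset u)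
        have h5 : (Xᶜ ∩ G.neighborFinset u).card = nbrsIn G Xᶜ u := by
          rw [nbrsIn]; congr 1; ext v; simp
        omega
      have hc' : ((Xᶜ \ G.neighborFinset u).card : ℝ) ≤ 1 + T := by exact_mod_cast hc
      have := sum_le_card_nsmul (Xᶜ \ G.neighborFinset u) (fun v => 1 - x v) 2
        fun v _ => by linarith [hge v]
      rw [nsmul_eq_mul] at this
      linarith
    have h2 : ∑ v ∈ Xᶜ, (1 - x v) ≤ ∑ v ∈ G.neighborFinset u, (1 - x v) +
        ∑ v ∈ Xᶜ \ G.neighborFinset u, (1 - x v) := by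
      rw [← sum_union disjoint_sdiff]
      refine sum_le_sum_of_subset_of_nonneg (fun v hv => ?_) fun v _ _ => by linarith [hle v]
      rw [union_sdiff_self_eq_union]
      exact mem_union_right _ hv
    rw [hdefect u, hu] at h2
    linarith [(hdeg u huX).2]
  constructor
  · intro w hw
    obtain ⟨h1, h2⟩ := hdeg w hw
    have h3 : ∑ v ∈ G.neighborFinset w, (1 - x v) ≤ ∑ v ∈ Xᶜ, (1 - x v) + ∑ v ∈ X, (1 - x v) := by
      rw [add_comm, sum_add_sum_compl]
      exact sum_le_sum_of_subset_of_nonneg (subset_univ _) fun v _ _ => by linarith [hle v]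
    have h4 := sum_le_card_nsmul X (fun v => 1 - x v) 2 fun v _ => by linarith [hge v]
    rw [nsmul_eq_mul, hX] at h4
    rw [hdefect w] at h3
    have h5 := (hdeg u huX).2
    have h6 : (1 - x w) * (n - 1 - 2 * s - y) ≤ (1 - x w) * (q - G.degree w) :=
      mul_le_mul_of_nonneg_left (by linarith) (by linarith [hle w])
    linarith
  · intro v hv
    have h1 : (G.degree v : ℝ) ≤ s + y := by exact_mod_cast hdX v hv
    have h2 : (q - G.degree v) * |x v| ≤ G.degree v := by
      have h3 : 0 ≤ q - G.degree v := by linarith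
      rw [← abs_of_nonneg h3, ← abs_mul, hx' v, ← card_neighborFinset_eq_degree,
        ← nsmul_one (G.neighborFinset v).card]
      exact (abs_sum_le_sum_abs _ _).trans (sum_le_card_nsmul _ _ _ fun w _ => hx1 w)
    have h6 : |x v| * (n - 1 - 2 * s - y) ≤ |x v| * (q - G.degree v) :=
      mul_le_mul_of_nonneg_left (by linarith) (abs_nonneg _)
    linarith

theorem exists_normalized {G : SimpleGraph V} {q : ℝ} {x : V → ℝ} (hx0 : x ≠ 0)
    (hx : ∀ u, q * x u = ∑ v ∈ G.neighborFinset u, (x u + x v)) :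
    ∃ z : V → ℝ, (∀ u, q * z u = ∑ v ∈ G.neighborFinset u, (z u + z v)) ∧
      (∀ v, |z v| ≤ 1) ∧ ∃ u, z u = 1 := by
  obtain ⟨w, hw⟩ := Function.ne_iff.1 hx0
  obtain ⟨u, -, hu⟩ := exists_max_image univ (fun v => |x v|) ⟨w, mem_univ w⟩
  have hpos : 0 < |x u| := (abs_pos.2 hw).trans_le (hu w (mem_univ w))
  refine ⟨fun v => x v / x u, fun v => ?_, fun v => ?_, u, div_self (abs_pos.1 hpos)⟩
  · simp_rw [← add_div]
    rw [← sum_div, ← hx v, mul_div_assoc]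
  · rw [abs_div, div_le_one hpos]
    exact hu v (mem_univ v)

/-- A bound for the number of vertices above which `two_mul_sum_nbrsIn_compl_le` applies. -/
def spectralThreshold (s y : ℕ) : ℕ :=
  (7 * s + 4 * (2 * s * s + 2 * s * y + s) + 2 + y) *
    (4 * (2 * s * s + 2 * s * y + s) + 3 * s * y + 2 * s * s + 1) + 2 * s + y + 2

theorem two_mul_sum_nbrsIn_compl_le {G : SimpleGraph V} {n s y : ℕ} {X Y : Finset V} {q : ℝ}
    {x : V → ℝ} (hn : Fintype.card V = n) (hX : X.card = s) (hY : Y.card = y)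
    (hXY : ∀ u ∈ X, ∀ v, v ∉ X → G.Adj u v → v ∈ Y) (hx0 : x ≠ 0)
    (hx : ∀ u, q * x u = ∑ v ∈ G.neighborFinset u, (x u + x v))
    (hq : 2 * ((n : ℝ) - s - 1) ≤ q) (hsum : n * n ≤ ∑ v, G.degree v + (2 * s + 1) * n)
    (hlarge : spectralThreshold s y ≤ n) :
    2 * ∑ w ∈ Xᶜ, nbrsIn Gᶜ Xᶜ w ≤ s * y := by
  obtain ⟨z, hz, hz1, u, hu⟩ := exists_normalized hx0 hx
  set T := 2 * s * s + 2 * s * y + s with hT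
  have hTsum : ∑ w ∈ Xᶜ, nbrsIn Gᶜ Xᶜ w ≤ T := sum_nbrsIn_compl_le hn hX hY hXY hsum
  have hdX : ∀ v ∈ X, G.degree v ≤ s + y := fun v hv => by
    rw [← nbrsIn_add_compl G X v, ← hX, ← hY]
    refine add_le_add (nbrsIn_le_card _ _ _) (card_le_card fun w hw => ?_)
    rw [mem_filter, mem_compl] at hw
    exact hXY v hv w hw.1 hw.2
  unfold spectralThreshold at hlarge
  rw [← hT] at hlarge
  have hns : 2 * s + y + 1 < n := by
    have := Nat.zero_le ((7 * s + 4 * T + 2 + y) * (4 * T + 3 * s * y + 2 * s * s + 1))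
    omega
  obtain ⟨hW, hXz⟩ := eigenvector_estimates hn hX hdX
    (fun w hw => (single_le_sum (f := fun w => nbrsIn Gᶜ Xᶜ w) (fun _ _ => Nat.zero_le _) hw).trans
      hTsum) hz hq hns hz1 hu
  obtain ⟨t, ht⟩ : ∃ t, t = ∑ w ∈ Xᶜ, nbrsIn Gᶜ Xᶜ w := ⟨_, rfl⟩
  have hns' : 0 < (n : ℝ) - 1 - 2 * s - y := by
    have : 2 * (s : ℝ) + y + 1 < n := by exact_mod_cast hns
    linarith
  obtain ⟨η, hη⟩ : ∃ η : ℝ, η = (7 * s + 4 * T + 2 + y) / ((n : ℝ) - 1 - 2 * s - y) := ⟨_, rfl⟩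
  have hη0 : 0 ≤ η := by rw [hη]; positivity
  have hηlt : η * (4 * T + 3 * s * y + 2 * s * s + 1) < 1 := by
    rw [hη, div_mul_eq_mul_div, div_lt_one hns']
    have : (((7 * s + 4 * T + 2 + y) * (4 * T + 3 * s * y + 2 * s * s + 1) + 2 * s + y + 2 : ℕ) : ℝ)
      ≤ n := by exact_mod_cast hlarge
    push_cast at this
    linarith
  have hη1 : η ≤ 1 := by
    have : 0 ≤ η * (4 * T + 3 * s * y + 2 * s * s) := by positivity
    linarith
  have hmain := mul_sum_nbrsIn_compl_le_of_rayleigh hn hX hY hXY hz hq (by omega) hη1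
    (fun w hw => by
      have := hW w hw
      rw [← le_div_iff₀ hns', ← hη] at this
      linarith) hz1 (fun v hv => by
      have := hXz v hv
      rwa [← le_div_iff₀ hns', ← hη] at this)
  rw [← ht] at hTsum hmain ⊢
  -- By integrality, failure means 2t ≥ sy + 1. With η² ≤ η, the Rayleigh bound then gives η(4T +
  -- 3sy + 2s²) ≥ 1, which `hηlt` excludes.
  by_contra hcon
  push Not at hcon
  have hcon' : (s : ℝ) * y + 1 ≤ 2 * t := by exact_mod_cast hcon
  have htT : (t : ℝ) ≤ T := by exact_mod_cast hTsum
  have ht0 : (0 : ℝ) ≤ t := Nat.cast_nonneg t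
  have hη2 : η ^ 2 ≤ η := by nlinarith
  have e1 : η * (t : ℝ) ≤ η * T := mul_le_mul_of_nonneg_left htT hη0
  have e2 : (0 : ℝ) ≤ s * y := by positivity
  have e3 : (0 : ℝ) ≤ s * s := by positivity
  have e4 := mul_le_mul_of_nonneg_left hη2 e2
  have e5 := mul_le_mul_of_nonneg_left hη2 e3
  have e6 : 0 ≤ η ^ 2 * t := by positivity
  nlinarith

end Spectral

/-! ### Identification with the two families. -/

section Families

open scoped Classical

variable {V : Type*} [Fintype V]

theorem exists_equiv_of_card {X Y : Finset V} {s y z : ℕ} (hXY : Disjoint X Y)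
    (hX : X.card = s) (hY : Y.card = y) (hV : Fintype.card V = y + (z + s)) :
    ∃ f : Fin y ⊕ (Fin z ⊕ Fin s) ≃ V, (∀ a, f (Sum.inl a) ∈ Y) ∧
      (∀ a, f (Sum.inr (Sum.inl a)) ∉ Y ∧ f (Sum.inr (Sum.inl a)) ∉ X) ∧
      ∀ a, f (Sum.inr (Sum.inr a)) ∈ X := by
  have hZ : (X ∪ Y)ᶜ.card = z := by
    rw [card_compl, card_union_of_disjoint hXY]
    omega
  let eX := X.equivFinOfCardEq hX
  let eY := Y.equivFinOfCardEq hY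
  let eZ := (X ∪ Y)ᶜ.equivFinOfCardEq hZ
  let f : Fin y ⊕ (Fin z ⊕ Fin s) → V :=
    Sum.elim (fun a => eY.symm a) (Sum.elim (fun a => eZ.symm a) (fun a => eX.symm a))
  have h1 : ∀ a, f (Sum.inl a) ∈ Y := fun a => (eY.symm a).2
  have h2 : ∀ a, f (Sum.inr (Sum.inl a)) ∉ Y ∧ f (Sum.inr (Sum.inl a)) ∉ X := fun a => by
    have := (eZ.symm a).2
    rw [mem_compl, mem_union, not_or] at this
    exact this.symm
  have h3 : ∀ a, f (Sum.inr (Sum.inr a)) ∈ X := fun a => (eX.symm a).2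
  have hd : ∀ {v}, v ∈ X → v ∉ Y := fun h => disjoint_left.1 hXY h
  have hinj : Function.Injective f := by
    rintro (a | a | a) (b | b | b) hab
    · exact congrArg _ (eY.symm.injective (Subtype.ext hab))
    · exact ((h2 b).1 (hab ▸ h1 a)).elim
    · exact (hd (h3 b) (hab ▸ h1 a)).elim
    · exact ((h2 a).1 (hab ▸ h1 b)).elim
    · exact congrArg (fun t => Sum.inr (Sum.inl t)) (eZ.symm.injective (Subtype.ext hab))
    · exact ((h2 a).2 (hab ▸ h3 b)).elim
    · exact (hd (h3 a) (hab ▸ h1 b)).elim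
    · exact ((h2 b).2 (hab ▸ h3 a)).elim
    · exact congrArg (fun t => Sum.inr (Sum.inr t)) (eX.symm.injective (Subtype.ext hab))
  refine ⟨Equiv.ofBijective f ((Fintype.bijective_iff_injective_and_card f).2 ⟨hinj, ?_⟩),
    h1, h2, h3⟩
  simp [hV]

/-- The deleted edges are the nonadjacent pairs of G off X. The sum in `hc` counts each pair twice,
whence the division by 4. -/
theorem exists_deleteEdges_iso {Y' Z' X' : Type*} {B : SimpleGraph (Y' ⊕ (Z' ⊕ X'))}
    {G : SimpleGraph V} {X : Finset V} {c : ℕ} (f : Y' ⊕ (Z' ⊕ X') ≃ V)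
    (hfX : ∀ a, f (Sum.inr (Sum.inr a)) ∈ X)
    (hfX' : ∀ p, f p ∈ X → ∃ a, p = Sum.inr (Sum.inr a))
    (hGB : ∀ p q, G.Adj (f p) (f q) → B.Adj p q)
    (hBG : ∀ a q, B.Adj (Sum.inr (Sum.inr a)) q → G.Adj (f (Sum.inr (Sum.inr a))) (f q))
    (hc : 2 * ∑ w ∈ Xᶜ, nbrsIn Gᶜ Xᶜ w ≤ c) :
    ∃ E' : Finset (Sym2 (Y' ⊕ (Z' ⊕ X'))), (E' : Set _) ⊆ edgesYZ B ∧ E'.card ≤ c / 4 ∧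
      Nonempty (G ≃g B.deleteEdges (E' : Set _)) := by
  let K : SimpleGraph V := ⟨fun u v => (u ≠ v ∧ ¬ G.Adj u v) ∧ u ∉ X ∧ v ∉ X,
    ⟨fun u v h => ⟨⟨h.1.1.symm, fun h' => h.1.2 h'.symm⟩, h.2.2, h.2.1⟩⟩, ⟨fun u h => h.1.1 rfl⟩⟩
  have hK : 2 * K.edgeFinset.card = ∑ w ∈ Xᶜ, nbrsIn Gᶜ Xᶜ w := by
    rw [← K.sum_degrees_eq_twice_card_edges, ← sum_add_sum_compl X]
    have h1 : ∑ v ∈ X, K.degree v = 0 := sum_eq_zero fun v hv => by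
      by_contra hcon
      obtain ⟨w, hw⟩ := (K.degree_pos_iff_exists_adj v).1 (Nat.pos_of_ne_zero hcon)
      exact hw.2.1 hv
    rw [h1, zero_add]
    refine sum_congr rfl fun v hv => ?_
    obtain ⟨L, hL⟩ : ∃ L, L = Gᶜ := ⟨_, rfl⟩
    rw [← hL, ← card_neighborFinset_eq_degree, nbrsIn]
    congr 1
    ext w
    rw [mem_compl] at hv
    rw [mem_neighborFinset, mem_filter, mem_compl, hL, compl_adj]
    exact ⟨fun h => ⟨h.2.2, h.1⟩, fun h => ⟨h.2, hv, h.1⟩⟩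
  set E' := (K.edgeFinset.image (Sym2.map f.symm)).filter (· ∈ B.edgeSet) with hE'
  have hmem : ∀ p q, s(p, q) ∈ E' ↔ K.Adj (f p) (f q) ∧ B.Adj p q := by
    intro p q
    rw [hE', mem_filter, mem_image, mem_edgeSet]
    refine and_congr_left fun _ => ⟨?_, fun h => ⟨s(f p, f q), by simpa using h, by simp⟩⟩
    rintro ⟨e, he, hep⟩
    have : e = s(f p, f q) := by
      have := congrArg (Sym2.map f) hep
      simpa [Sym2.map_map] using this
    rw [this] at he
    simpa using he
  refine ⟨E', ?_, ?_, ⟨⟨f.symm, ?_⟩⟩⟩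
  · intro e he
    induction e with | h p q =>
    obtain ⟨h1, h2⟩ := (hmem p q).1 he
    refine ⟨h2, fun x hx => ?_⟩
    rw [Sym2.mem_iff] at hx
    rcases hx with rfl | rfl
    · exact h1.2.1 (hfX x)
    · exact h1.2.2 (hfX x)
  · have h1 : E'.card ≤ K.edgeFinset.card := (card_filter_le _ _).trans card_image_le
    omega
  · intro u v
    obtain ⟨p, rfl⟩ := f.surjective u
    obtain ⟨q, rfl⟩ := f.surjective v
    rw [Equiv.symm_apply_apply, Equiv.symm_apply_apply, deleteEdges_adj, mem_coe, hmem]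
    constructor
    · rintro ⟨hB, hE⟩
      by_contra hcon
      have hp : f p ∉ X := fun h => by
        obtain ⟨a, rfl⟩ := hfX' p h
        exact hcon (hBG a q hB)
      have hq : f q ∉ X := fun h => by
        obtain ⟨a, rfl⟩ := hfX' q h
        exact hcon (hBG a p hB.symm).symm
      exact hE ⟨⟨⟨fun h => hB.ne (f.injective h), hcon⟩, hp, hq⟩, hB⟩
    · exact fun h => ⟨hGB p q h, fun h' => h'.1.1.2 h⟩

theorem inFamilyH_of_structure {G : SimpleGraph V} {n k δ : ℕ} {X Y : Finset V} (hk : k ≤ δ)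
    (hn : Fintype.card V = n) (hlarge : 2 * δ ≤ n) (hX : X.card = δ - k) (hY : Y.card = δ)
    (hXY : Disjoint X Y) (hjoin : ∀ u ∈ X, ∀ v ∈ Y, G.Adj u v)
    (hXZ : ∀ u ∈ X, ∀ v, v ∉ X → G.Adj u v → v ∈ Y) (hindep : ∀ u ∈ X, ∀ v ∈ X, ¬ G.Adj u v)
    (hc : 2 * ∑ w ∈ Xᶜ, nbrsIn Gᶜ Xᶜ w ≤ δ * (δ - k)) : InFamilyH n k δ G := by
  obtain ⟨f, h1, h2, h3⟩ := exists_equiv_of_card (z := n + k - 2 * δ) hXY hX hY (by omega)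
  refine exists_deleteEdges_iso f h3 ?_ ?_ ?_ hc
  · rintro (a | a | a) h
    · exact (disjoint_left.1 hXY h (h1 a)).elim
    · exact ((h2 a).2 h).elim
    · exact ⟨a, rfl⟩
  · rintro (a | a | a) (b | b | b) h
    case inr.inl.inr.inr => exact ((h2 a).1 (hXZ _ (h3 b) _ (h2 a).2 h.symm)).elim
    case inr.inr.inr.inl => exact ((h2 b).1 (hXZ _ (h3 a) _ (h2 b).2 h)).elim
    case inr.inr.inr.inr => exact (hindep _ (h3 a) _ (h3 b) h).elim
    all_goals
      have := h.ne
      simp_all [graphH, join]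
  · rintro a (b | b | b) h
    · exact hjoin _ (h3 a) _ (h1 b)
    · simp [graphH, join] at h
    · simp [graphH, join] at h

theorem inFamilyL_of_structure {G : SimpleGraph V} {n k δ : ℕ} {X Y : Finset V} (hk : k ≤ δ)
    (hn : Fintype.card V = n) (hlarge : 2 * δ + 1 ≤ n) (hX : X.card = δ - k)
    (hY : Y.card = k + 1)
    (hXY : Disjoint X Y) (hjoin : ∀ u ∈ X, ∀ v ∈ Y, G.Adj u v)
    (hXZ : ∀ u ∈ X, ∀ v, v ∉ X → G.Adj u v → v ∈ Y)
    (hclique : ∀ u ∈ X, ∀ v ∈ X, u ≠ v → G.Adj u v)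
    (hc : 2 * ∑ w ∈ Xᶜ, nbrsIn Gᶜ Xᶜ w ≤ (k + 1) * (δ - k)) : InFamilyL n k δ G := by
  obtain ⟨f, h1, h2, h3⟩ := exists_equiv_of_card (z := n - δ - 1) hXY hX hY (by omega)
  refine exists_deleteEdges_iso f h3 ?_ ?_ ?_ hc
  · rintro (a | a | a) h
    · exact (disjoint_left.1 hXY h (h1 a)).elim
    · exact ((h2 a).2 h).elim
    · exact ⟨a, rfl⟩
  · rintro (a | a | a) (b | b | b) h
    case inr.inl.inr.inr => exact ((h2 a).1 (hXZ _ (h3 b) _ (h2 a).2 h.symm)).elim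
    case inr.inr.inr.inl => exact ((h2 b).1 (hXZ _ (h3 a) _ (h2 b).2 h)).elim
    all_goals
      have := h.ne
      simp_all [graphL, join]
  · rintro a (b | b | b) h
    · exact hjoin _ (h3 a) _ (h1 b)
    · simp [graphL, join] at h
    · exact hclique _ (h3 a) _ (h3 b) (f.injective.ne h.ne)

theorem isEdgeHamiltonian_or_inFamily {G : SimpleGraph V} {n k δ : ℕ} {q : ℝ} {x : V → ℝ}
    (hδ : k + 2 ≤ δ) (hn : Fintype.card V = n) (hdeg : ∀ v, δ ≤ G.degree v) (hx0 : x ≠ 0)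
    (hx : ∀ u, q * x u = ∑ v ∈ G.neighborFinset u, (x u + x v))
    (hq : 2 * ((n : ℝ) - (δ : ℝ) + (k : ℝ) - 1) ≤ q) (h50 : 50 * (δ + 1) ^ 2 ≤ n)
    (h₁ : spectralThreshold (δ - k) δ ≤ n) (h₂ : spectralThreshold (δ - k) (k + 1) ≤ n) :
    IsEdgeHamiltonian k G ∨ InFamilyH n k δ G ∨ InFamilyL n k δ G := by
  obtain ⟨s, rfl⟩ : ∃ s, δ = s + k := ⟨δ - k, by omega⟩
  have hsk : s + k - k = s := by omega
  rw [hsk] at h₁ h₂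
  have hlin : 2 * (s + k) + 1 ≤ n := by nlinarith
  have hq' : 2 * ((n : ℝ) - s - 1) ≤ q := by
    push_cast at hq
    linarith
  have hsum := sum_degree_lower_bound hn hx0 hx (fun v => by have := hdeg v; omega) hq'
  by_contra hcon
  rw [not_or, not_or] at hcon
  obtain ⟨hham, hH, hL⟩ := hcon
  unfold IsEdgeHamiltonian at hham
  push Not at hham
  obtain ⟨F, hFG, hF, hFk, hno⟩ := hham
  have hFk' : F.edgeFinset.card ≤ k := by
    rw [← coe_edgeFinset, Set.encard_coe_eq_coe_finsetCard] at hFk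
    exact_mod_cast hFk
  obtain ⟨X, Y, hX, hXY, hjoin, hXZ, hcase⟩ := exists_structure hn hdeg hsum h50 hF hFG
    hFk' (by
      rintro ⟨a, c, hc, hcF⟩
      obtain ⟨e, he, hne⟩ := hno a c hc
      exact hne (hcF e he))
  rcases hcase with ⟨hY, hindep⟩ | ⟨hY, hclique⟩
  · have hc := two_mul_sum_nbrsIn_compl_le hn hX hY hXZ hx0 hx hq' hsum h₁
    exact hH (inFamilyH_of_structure (by omega) hn (by omega) (by rw [hX, hsk]) hY hXY hjoin hXZ
      hindep (by rwa [hsk, mul_comm (s + k)]))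
  · have hc := two_mul_sum_nbrsIn_compl_le hn hX hY hXZ hx0 hx hq' hsum h₂
    exact hL (inFamilyL_of_structure (by omega) hn (by omega) (by rw [hX, hsk]) hY hXY hjoin hXZ
      hclique (by rwa [hsk, mul_comm (k + 1)]))

end Families

end SpectralHam

theorem theorem2p3 (k δ : ℕ) (hδ : k + 2 ≤ δ) :
    ∃ N : ℕ, ∀ n : ℕ, N ≤ n →
      ∀ (V : Type*) [Fintype V] [DecidableEq V] (G : SimpleGraph V) [DecidableRel G.Adj],
        Fintype.card V = n → δ ≤ G.minDegree →
        2 * ((n : ℝ) - (δ : ℝ) + (k : ℝ) - 1) ≤ SpectralHam.signlessRadius G →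
        SpectralHam.IsEdgeHamiltonian k G ∨
          SpectralHam.InFamilyH n k δ G ∨ SpectralHam.InFamilyL n k δ G := by
  refine ⟨50 * (δ + 1) ^ 2 + SpectralHam.spectralThreshold (δ - k) δ +
    SpectralHam.spectralThreshold (δ - k) (k + 1), fun n hN V _ instV G instG hn hmin hq => ?_⟩
  have : Nonempty V := Fintype.card_pos_iff.1 (by
    have : 0 < (δ + 1) ^ 2 := by positivity
    omega)
  have hdeg : ∀ v, δ ≤ G.degree v := fun v => hmin.trans (G.minDegree_le_degree v)
  obtain ⟨x, hx0, hx⟩ := SpectralHam.exists_signlessRadius_eigenvector G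
  -- Once q is opaque, the given decidability instances can be replaced by classical ones.
  generalize SpectralHam.signlessRadius G = q at hq hx
  obtain rfl : instV = fun a b => Classical.propDecidable _ := Subsingleton.elim _ _
  obtain rfl : instG = fun a b => Classical.propDecidable _ := Subsingleton.elim _ _
  exact SpectralHam.isEdgeHamiltonian_or_inFamily hδ hn hdeg hx0 hx hq (by omega) (by omega)
    (by omega)
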